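/- **Setting.** Let $\tau,\varepsilon,\varepsilon_0,\beta>0$ and $\lambda\in\mathbb R$, and put $\eta=\big(\tfrac{(\varepsilon-\varepsilon_0)\tau}{2\pi}\big)^2$, $\xi=\big(\tfrac{\lambda\tau}{\pi}\big)^2$, $p_{\rm at}(-)=\frac1{1+e^{-\beta\varepsilon}}$, $p_{\rm at}(+)=\frac{e^{-\beta\varepsilon}}{1+e^{-\beta\varepsilon}}$. On the bosonic Fock space $\mathcal H=\ell^2(\mathbb N)$ with Fock basis $(|n\rangle)_{n\in\mathbb N}$, number operator $N$ and annihilation and creation operators $a,a^*$, put $$C(n)=\cos\!\big(\pi\sqrt{\xi n+\eta}\big)+i\,\eta^{1/2}\frac{\sin(\pi\sqrt{\xi n+\eta})}{\sqrt{\xi n+\eta}},\qquad S(n)=\xi^{1/2}\frac{\sin(\pi\sqrt{\xi n+\eta})}{\sqrt{\xi n+\eta}},$$ $$V_{--}=p_{\rm at}(-)^{1/2}e^{-i\tau\varepsilon N}C(N),\quad V_{-+}=p_{\rm at}(-)^{1/2}e^{-i\tau\varepsilon N}S(N+1)\,a,$$ $$V_{+-}=p_{\rm at}(+)^{1/2}e^{-i\tau\varepsilon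 N}S(N)\,a^*,\quad V_{++}=p_{\rm at}(+)^{1/2}e^{-i\tau\varepsilon N}C(N+1)^* .$$ (No assumption is made on the existence of Rabi resonances.) Let $\mathcal R=\{-,+\}^2$ and $\Omega=\mathcal R^{\mathbb N^*}$ with its cylinder $\sigma$-algebra, and $W_t(\omega)=V_{\omega_t}\cdots V_{\omega_1}$. A state is a positive semidefinite trace class operator on $\mathcal H$ of trace one. For a state $\rho$, let $\mathbb P^\rho$ be the probability measure on $\Omega$ which gives each cylinder set $\{z: z_1=\omega_1,\dots,z_t=\omega_t\}$ the probability $\mathrm{Tr}(\rho W_t(\omega)^*W_t(\omega))$, and let $\rho_t=\dfrac{W_t\rho W_t^*}{\mathrm{Tr}(W_t\rho W_t^*)}$ be the quantum trajectory started at $\rho$. Let $\rho_{\rm inv}=e^{-\beta\varepsilon N}/\mathrm{Tr}(e^{-\beta\varepsilon N})$, $$M_t=\frac{\rho_{\rm inv}^{1/2}W_t^*W_t\rho_{\rm inv}^{1/2}}{\mathrm{Tr}(W_t^*W_t\rho_{\rm inv})},$$ and let $M_\infty$ be the limit of $M_t$ in trace norm as $t\to\infty$ where that limit exists (and $M_\infty=0$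 elsewhere). **Proposition.** Let $\mathcal N$ be a maximal subset of $\mathbb N$ such that for all $n,m\in\mathcal N$, $s\in\mathbb N^*$ and $\zeta_1,\dots,\zeta_s\in\mathcal R$, $$\|V_{\zeta_s}\cdots V_{\zeta_1}|m\rangle\|^2=\|V_{\zeta_s}\cdots V_{\zeta_1}|n\rangle\|^2 ,$$ and let $Q$ be the orthogonal projection onto the closed subspace spanned by $\{|n\rangle:n\in\mathcal N\}$. Then for every state $\rho$, $\mathbb P^\rho$-almost surely $M_t\to M_\infty$ in trace norm, and $$\mathbb P^\rho\Big(M_\infty=\frac{Q\rho_{\rm inv}Q}{\mathrm{Tr}(\rho_{\rm inv}Q)}\Big)=\mathrm{Tr}(\rho Q).$$ Moreover, if $\operatorname{Card}\mathcal N\ge 2$, there exists a state $\rho$ such that, $\mathbb P^\rho$-almost surely, $$\inf_{\phi\in\mathcal H,\ \|\phi\|=1}\big\|\rho_t-|\phi\rangle\langle\phi|\big\|_1=1\quad\text{for every } t\in\mathbb N^*,$$ and in particular $$\inf_{t\in\mathbb N^*}\ \inf_{\phi\in\mathcal H,\ \|\phi\|=1}\big\|\rho_t-|\phi\rangle\langle\phi|\big\|_1=1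 .$$ -/

import Mathlib

open MeasureTheory ProbabilityTheory Filter Topology
open scoped ENNReal ComplexOrder

noncomputable section

namespace Maser

/-! ### Fock space, trace and trace norm -/

/-- The square root of a positive operator on a Hilbert space. -/
def opSqrt {H : Type*} [NormedAddCommGroup H] [InnerProductSpace ℂ H] [CompleteSpace H]
    (A : H →L[ℂ] H) : H →L[ℂ] H := CFC.sqrt A

/-- The absolute value `|A| = (A* A)^{1/2}` of an operator on a Hilbert space. -/
def opAbs {H : Type*} [NormedAddCommGroup H] [InnerProductSpace ℂ H] [CompleteSpace H]
    (A : H →L[ℂ] H) : H →L[ℂ] H := opSqrt (star A * A)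

/-- The bosonic Fock space over `ℂ`, i.e. the Hilbert space `ℓ²(ℕ)`. -/
abbrev Fock : Type := lp (fun _ : ℕ => ℂ) 2

/-- The bounded operators on the Fock space. -/
abbrev Op : Type := Fock →L[ℂ] Fock

/-- The Fock vector `|n⟩`. -/
def fock (n : ℕ) : Fock := lp.single 2 n 1

lemma norm_fock (n : ℕ) : ‖fock n‖ = 1 := by
  simp [fock, lp.norm_single]

lemma inner_fock (n : ℕ) (x : Fock) : inner ℂ (fock n) x = x n := by
  simp [fock, lp.inner_single_left]

/-- The trace, computed in the Fock basis. -/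
def tr (A : Op) : ℂ := ∑' n, inner ℂ (fock n) (A (fock n))

/-- The trace norm `‖A‖₁ = Tr |A|`, computed in the Fock basis. It is `∞` exactly when `A` is not
trace class. -/
def traceNorm (A : Op) : ℝ≥0∞ :=
  ∑' n, ENNReal.ofReal (inner ℂ (fock n) (opAbs A (fock n))).re

/-- A state: a positive semidefinite trace class operator with unit trace. -/
structure State where
  op : Op
  isPositive : op.IsPositive
  traceClass : traceNorm op ≠ ∞
  trace_one : tr op = 1

/-- A linear map on sequences which does not increase the `ℓ²` norm, as an operator on the Fock
space. -/
def contraction (T : (ℕ → ℂ) →ₗ[ℂ] (ℕ → ℂ))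
    (hT : ∀ (x : Fock) (s : Finset ℕ), ∑ n ∈ s, ‖T x n‖ ^ 2 ≤ ‖x‖ ^ 2) : Op :=
  LinearMap.mkContinuous
    { toFun := fun x => (⟨T x, memℓp_gen' (C := ‖x‖ ^ 2) (by
        intro s; simpa using hT x s)⟩ : Fock)
      map_add' := by
        intro x y; apply lp.ext; exact T.map_add x y
      map_smul' := by
        intro c x; apply lp.ext; exact T.map_smul c x } 1
    (by
      intro x
      apply lp.norm_le_of_forall_sum_le (by simp) (by positivity)
      intro s
      simpa using hT x s)

@[simp] lemma contraction_apply (T : (ℕ → ℂ) →ₗ[ℂ] (ℕ → ℂ)) (hT) (x : Fock) (n : ℕ) :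
    contraction T hT x n = T x n := rfl

lemma sum_sq_le (x : Fock) (s : Finset ℕ) : ∑ n ∈ s, ‖x n‖ ^ 2 ≤ ‖x‖ ^ 2 := by
  simpa using lp.sum_rpow_le_norm_rpow (p := 2) (by simp) x s

/-- The annihilation operator, `a|n⟩ = √n |n-1⟩`, on sequences of coordinates. -/
def annihilation : (ℕ → ℂ) →ₗ[ℂ] (ℕ → ℂ) where
  toFun x n := (√(n + 1 : ℝ) : ℂ) * x (n + 1)
  map_add' x y := by funext n; simp [mul_add]
  map_smul' c x := by funext n; simp [mul_left_comm]

/-- The creation operator, `a*|n⟩ = √(n+1) |n+1⟩`, on sequences of coordinates. -/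
def creation : (ℕ → ℂ) →ₗ[ℂ] (ℕ → ℂ) where
  toFun x n := (√(n : ℝ) : ℂ) * x (n - 1)
  map_add' x y := by funext n; simp [mul_add]
  map_smul' c x := by funext n; simp [mul_left_comm]

/-- The function `f(N)` of the number operator `N`, on sequences of coordinates. -/
def ofNumber (f : ℕ → ℂ) : (ℕ → ℂ) →ₗ[ℂ] (ℕ → ℂ) where
  toFun x n := f n * x n
  map_add' x y := by funext n; simp [mul_add]
  map_smul' c x := by funext n; simp [mul_left_comm]

/-! ### Kolmogorov extension for a finite alphabet -/

lemma exists_step {R : Type} [Fintype R] [Nonempty R] [MeasurableSpace R] [MeasurableSingletonClass R]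
    (q : List R → ℝ≥0∞) (h : ∀ w, ∑ y, q (w ++ [y]) = q w)
    (hf : ∀ w, q w ≠ ∞) (w : List R) :
    ∃ m : Measure R, IsProbabilityMeasure m ∧ ∀ y, q w * m {y} = q (w ++ [y]) := by
  classical
  by_cases h0 : q w = 0
  · refine ⟨Measure.dirac (Classical.arbitrary R), inferInstance, fun y => ?_⟩
    have := h w
    rw [h0, Finset.sum_eq_zero_iff] at this
    rw [h0, zero_mul, this y (Finset.mem_univ y)]
  · refine ⟨∑ y, (q (w ++ [y]) / q w) • Measure.dirac y, ⟨?_⟩, fun y => ?_⟩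
    · simp only [Measure.coe_finsetSum, Finset.sum_apply, Measure.smul_apply, measure_univ,
        smul_eq_mul, mul_one, div_eq_mul_inv, ← Finset.sum_mul]
      rw [h w, ENNReal.mul_inv_cancel h0 (hf w)]
    · simp only [Measure.coe_finsetSum, Finset.sum_apply, Measure.smul_apply, smul_eq_mul,
        Measure.dirac_apply]
      rw [Finset.sum_eq_single y]
      · simp [ENNReal.mul_div_cancel h0 (hf w)]
      · intro b _ hb; simp [hb]
      · simp

/-- Existence of a measure on sequences with prescribed consistent cylinder probabilities. -/
theorem exists_measure_of_consistent {R : Type} [Fintype R] [Nonempty R] [MeasurableSpace R] [MeasurableSingletonClass R]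
    (q : List R → ℝ≥0∞) (h0 : q [] = 1)
    (h : ∀ w, ∑ y, q (w ++ [y]) = q w) :
    ∃ μ : Measure (ℕ → R), IsProbabilityMeasure μ ∧
      ∀ (ω : ℕ → R) (t : ℕ), μ {z | ∀ i < t, z i = ω i} = q ((List.range t).map ω) := by
  classical
  have hf : ∀ w, q w ≠ ∞ := by
    intro w
    induction w using List.reverseRecOn with
    | nil => simp [h0]
    | append_singleton w y ih =>
      refine ne_top_of_le_ne_top ih ?_
      rw [← h w]
      exact Finset.single_le_sum (f := fun y => q (w ++ [y])) (fun _ _ => zero_le) (Finset.mem_univ y)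
  choose step hstep hq using exists_step q h hf
  let word : (n : ℕ) → (Finset.Iic n → R) → List R := fun n x => (List.range (n + 1)).map
    fun i => if hi : i ∈ Finset.Iic n then x ⟨i, hi⟩ else Classical.arbitrary R
  let κ : (n : ℕ) → Kernel (Finset.Iic n → R) R := fun n =>
    ⟨fun x => step (word n x), measurable_of_finite _⟩
  have hκ : ∀ n, IsMarkovKernel (κ n) := fun n => ⟨fun x => hstep _⟩
  have hs0 := hstep []
  let μ : Measure (ℕ → R) := Kernel.trajMeasure (X := fun _ => R) (step []) κ
  have hμ : IsProbabilityMeasure μ := by dsimp only [μ]; infer_instance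
  refine ⟨μ, hμ, fun ω t => ?_⟩
  let r : (n : ℕ) → (ℕ → R) → (Finset.Iic n → R) := fun n z i => z i
  have hr : ∀ n, Measurable (r n) := fun n => by fun_prop
  have hword : ∀ n, word n (r n ω) = (List.range (n + 1)).map ω := by
    intro n
    refine List.map_congr_left fun i hi => ?_
    have : i ∈ Finset.Iic n := by simp at hi ⊢; omega
    simp [this, r]
  have hset : ∀ n, {z : ℕ → R | ∀ i < n + 1, z i = ω i} =
      r n ⁻¹' {r n ω} := by
    intro n; ext z
    simp only [Set.mem_ofPred_eq, Set.mem_preimage, Set.mem_singleton_iff, funext_iff]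
    constructor
    · intro hz i; exact hz i (Nat.lt_succ_of_le (Finset.mem_Iic.1 i.2))
    · intro hz i hi; exact hz ⟨i, by simp; omega⟩
  induction t with
  | zero => simp [h0]
  | succ t ih =>
    cases t with
    | zero =>
      have e := hq [] (ω 0)
      rw [h0, one_mul] at e
      simp only [zero_add, Nat.lt_one_iff, forall_eq, List.range_one, List.map_cons, List.map_nil]
      rw [show [ω 0] = [] ++ [ω 0] from rfl, ← e]
      have hm : μ.map (r 0) = (step []).map
          (MeasurableEquiv.piUnique (fun _ : Finset.Iic 0 => R)).symm := by
        change (Kernel.trajMeasure (X := fun _ => R) (step []) κ).map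
          (Preorder.frestrictLe (π := fun _ => R) 0) = _
        rw [Kernel.trajMeasure, Measure.map_comp _ _ (by fun_prop), Kernel.traj_map_frestrictLe,
          Kernel.partialTraj_self, Measure.id_comp]
      have hm2 := congrArg (fun ν => ν {r 0 ω}) hm
      beta_reduce at hm2
      rw [Measure.map_apply (hr 0) (measurableSet_singleton _), ← hset 0,
        Measure.map_apply (by fun_prop) (measurableSet_singleton _)] at hm2
      have hs : (MeasurableEquiv.piUnique (fun _ : Finset.Iic 0 => R)).symm ⁻¹' {r 0 ω} = {ω 0} := by
        ext y
        simp only [Set.mem_preimage, Set.mem_singleton_iff]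
        rw [MeasurableEquiv.symm_apply_eq]
        rfl
      rw [hs] at hm2
      simpa using hm2
    | succ n =>
      have hm := Kernel.map_frestrictLe_trajMeasure_compProd_eq_map_trajMeasure (X := fun _ => R)
        (μ₀ := step []) (κ := κ) (a := n)
      have hm2 := congrArg (fun ν => ν ({r n ω} ×ˢ {ω (n + 1)})) hm
      beta_reduce at hm2
      rw [Measure.compProd_apply_prod (measurableSet_singleton _) (measurableSet_singleton _),
        Measure.map_apply (by fun_prop) ((measurableSet_singleton _).prod (measurableSet_singleton _)),
        lintegral_singleton, Measure.map_apply (by fun_prop) (measurableSet_singleton _)] at hm2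
      change (κ n) (r n ω) {ω (n + 1)} * μ (r n ⁻¹' {r n ω}) =
        μ ((fun x => (r n x, x (n + 1))) ⁻¹' ({r n ω} ×ˢ {ω (n + 1)})) at hm2
      rw [← hset n] at hm2
      have hs : {z : ℕ → R | ∀ i < n + 1 + 1, z i = ω i} =
          (fun x : ℕ → R => (r n x, x (n + 1))) ⁻¹'
            ({r n ω} ×ˢ {ω (n + 1)}) := by
        have := hset n
        ext z
        have h2 := Set.ext_iff.1 this z
        simp only [Set.mem_ofPred_eq, Set.mem_preimage, Set.mem_singleton_iff] at h2
        simp only [Set.mem_ofPred_eq, Set.mem_preimage, Set.mem_prod, Set.mem_singleton_iff, ← h2]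
        constructor
        · intro hz; exact ⟨fun i hi => hz i (by omega), hz _ (by omega)⟩
        · rintro ⟨h1, h2⟩ i hi
          rcases Nat.lt_succ_iff_lt_or_eq.1 hi with h | h
          · exact h1 i h
          · rw [h]; exact h2
      rw [hs]
      refine hm2.symm.trans ?_
      rw [List.range_succ, List.map_append]
      rw [ih]
      have e := hq ((List.range (n+1)).map ω) (ω (n+1))
      rw [List.map_singleton, ← e, mul_comm, ← hword n]
      rfl

/-! ### The model -/

/-- The physical parameters of the one-atom maser: coupling constant `lam`, interaction time `tau`,
Bohr frequency `eps` of the atoms, frequency `eps0` of the cavity mode, inverse temperature `beta`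
of the atoms. -/
structure Params where
  lam : ℝ
  tau : ℝ
  eps : ℝ
  eps0 : ℝ
  beta : ℝ
  tau_pos : 0 < tau
  eps_pos : 0 < eps
  eps0_pos : 0 < eps0
  beta_pos : 0 < beta

/-- The outcome `(σ, σ')` of the two measurements on one atom; `false` is the ground state `-` and
`true` is the excited state `+`. -/
abbrev Outcome : Type := Bool × Bool

/-- The space of sequences of outcomes, with the product (cylinder) `σ`-algebra. The outcome
written `ω_j` (`j ≥ 1`) in the usual numbering is `ω (j - 1)`. -/
abbrev Omega : Type := ℕ → Outcome

namespace Params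

variable (p : Params)

/-- The dimensionless detuning parameter `η = (Δτ/2π)²`, with `Δ = ε - ε₀`. -/
def eta : ℝ := ((p.eps - p.eps0) * p.tau / (2 * Real.pi)) ^ 2

/-- The dimensionless coupling constant `ξ = (λτ/π)²`. -/
def xi : ℝ := (p.lam * p.tau / Real.pi) ^ 2

/-- The probabilities `p_at(-) = 1/(1+e^{-βε})` and `p_at(+) = e^{-βε}/(1+e^{-βε})`. -/
def pAt : Bool → ℝ
  | false => 1 / (1 + Real.exp (-p.beta * p.eps))
  | true => Real.exp (-p.beta * p.eps) / (1 + Real.exp (-p.beta * p.eps))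

/-- `C(n) = cos(π√(ξn+η)) + i η^{1/2} sin(π√(ξn+η))/√(ξn+η)`. When `ξn+η = 0` also `η = 0`, and
the second term vanishes whatever value is given to the quotient. -/
def C (n : ℕ) : ℂ :=
  (Real.cos (Real.pi * √(p.xi * n + p.eta)) : ℂ) + Complex.I *
    (√p.eta * (Real.sin (Real.pi * √(p.xi * n + p.eta)) / √(p.xi * n + p.eta)) : ℝ)

/-- `S(n) = ξ^{1/2} sin(π√(ξn+η))/√(ξn+η)`. It is only used for `n ≥ 1` (for `n = 0` it is
multiplied by `0`), and then `ξn+η = 0` forces `ξ = 0`. -/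
def S (n : ℕ) : ℝ :=
  √p.xi * (Real.sin (Real.pi * √(p.xi * n + p.eta)) / √(p.xi * n + p.eta))

/-- The free evolution `e^{-iτεn}`. -/
def phase (n : ℕ) : ℂ := Complex.exp (-(Complex.I * p.tau * p.eps * n))

/-- The Kraus operators on sequences of coordinates:
`V₋₋ = p_at(-)^{1/2} e^{-iτεN} C(N)`,       `V₋₊ = p_at(-)^{1/2} e^{-iτεN} S(N+1) a`,
`V₊₋ = p_at(+)^{1/2} e^{-iτεN} S(N) a*`,    `V₊₊ = p_at(+)^{1/2} e^{-iτεN} C(N+1)*`. -/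
def krausSeq : Outcome → (ℕ → ℂ) →ₗ[ℂ] (ℕ → ℂ)
  | (false, false) => (√(p.pAt false) : ℂ) • (ofNumber p.phase ∘ₗ ofNumber p.C)
  | (false, true) => (√(p.pAt false) : ℂ) •
      (ofNumber p.phase ∘ₗ ofNumber (fun n => (p.S (n + 1) : ℂ)) ∘ₗ annihilation)
  | (true, false) => (√(p.pAt true) : ℂ) •
      (ofNumber p.phase ∘ₗ ofNumber (fun n => (p.S n : ℂ)) ∘ₗ creation)
  | (true, true) => (√(p.pAt true) : ℂ) •
      (ofNumber p.phase ∘ₗ ofNumber (fun n => star (p.C (n + 1))))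

lemma pAt_nonneg (b : Bool) : 0 ≤ p.pAt b := by
  cases b <;> simp only [pAt] <;> positivity

lemma pAt_add : p.pAt false + p.pAt true = 1 := by
  have : 0 < 1 + Real.exp (-p.beta * p.eps) := by positivity
  simp only [pAt]; field_simp

lemma norm_phase (n : ℕ) : ‖p.phase n‖ = 1 := by
  have : -(Complex.I * p.tau * p.eps * n) = ((-(p.tau * p.eps * n) : ℝ) : ℂ) * Complex.I := by
    push_cast; ring
  rw [phase, this, Complex.norm_exp_ofReal_mul_I]

lemma eta_nonneg : 0 ≤ p.eta := sq_nonneg _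

lemma xi_nonneg : 0 ≤ p.xi := sq_nonneg _

lemma normSq_C_add (n : ℕ) : ‖p.C n‖ ^ 2 + n * p.S n ^ 2 = 1 := by
  have he := p.eta_nonneg
  have hx := p.xi_nonneg
  have hn : (0 : ℝ) ≤ n := n.cast_nonneg
  have h0 : 0 ≤ p.xi * n + p.eta := by positivity
  have hC : ‖p.C n‖ ^ 2 = Real.cos (Real.pi * √(p.xi * n + p.eta)) ^ 2 +
      (√p.eta * (Real.sin (Real.pi * √(p.xi * n + p.eta)) / √(p.xi * n + p.eta))) ^ 2 := by
    rw [C, ← Complex.normSq_eq_norm_sq, mul_comm Complex.I, Complex.normSq_add_mul_I]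
  rw [hC, S, mul_pow, mul_pow, Real.sq_sqrt he, Real.sq_sqrt hx, div_pow, Real.sq_sqrt h0]
  rcases h0.eq_or_lt with h | h
  · rw [← h]; simp
  · have := Real.cos_sq_add_sin_sq (Real.pi * √(p.xi * n + p.eta))
    field_simp
    linear_combination (p.xi * n + p.eta) * this

lemma norm_C_le (n : ℕ) : ‖p.C n‖ ≤ 1 := by
  have h := p.normSq_C_add n
  have : 0 ≤ n * p.S n ^ 2 := by positivity
  exact abs_le_of_sq_le_sq' (by linarith) (by norm_num) |>.2

lemma norm_S_le (n : ℕ) : |p.S n| * √(n : ℝ) ≤ 1 := by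
  have h := p.normSq_C_add n
  have h2 : 0 ≤ ‖p.C n‖ ^ 2 := by positivity
  refine (abs_le_of_sq_le_sq' ?_ (by norm_num)).2
  rw [mul_pow, sq_abs, Real.sq_sqrt n.cast_nonneg]; linarith

lemma norm_sqrt_pAt_le (b : Bool) : ‖(√(p.pAt b) : ℂ)‖ ≤ 1 := by
  rw [Complex.norm_real, Real.norm_eq_abs, abs_of_nonneg (Real.sqrt_nonneg _), Real.sqrt_le_one]
  have := p.pAt_nonneg false
  have := p.pAt_nonneg true
  have := p.pAt_add
  cases b <;> linarith

lemma krausSeq_bound (y : Outcome) (x : Fock) (s : Finset ℕ) :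
    ∑ n ∈ s, ‖p.krausSeq y x n‖ ^ 2 ≤ ‖x‖ ^ 2 := by
  have key : ∀ (b : Bool) (n : ℕ) (u v : ℂ), ‖u‖ ≤ 1 →
      ‖(√(p.pAt b) : ℂ) * (p.phase n * (u * v))‖ ^ 2 ≤ ‖v‖ ^ 2 := by
    intro b n u v hu
    gcongr
    rw [norm_mul, norm_mul, norm_mul, p.norm_phase, one_mul]
    have h1 := p.norm_sqrt_pAt_le b
    calc _ ≤ 1 * (1 * ‖v‖) := by gcongr
      _ = ‖v‖ := by ring
  match y with
  | (false, false) =>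
    exact (Finset.sum_le_sum fun n _ => key false n (p.C n) (x n) (p.norm_C_le n)).trans
      (sum_sq_le x s)
  | (true, true) =>
    exact (Finset.sum_le_sum fun n _ => key true n (star (p.C (n + 1))) (x n)
      (by simpa using p.norm_C_le (n + 1))).trans (sum_sq_le x s)
  | (false, true) =>
    have h : ∀ n ∈ s, ‖p.krausSeq (false, true) x n‖ ^ 2 ≤ ‖x (n + 1)‖ ^ 2 := by
      intro n _
      have := key false n ((p.S (n + 1) : ℂ) * (√((n : ℝ) + 1) : ℂ)) (x (n + 1)) (by
        have := p.norm_S_le (n + 1)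
        rw [norm_mul, Complex.norm_real, Complex.norm_real, Real.norm_eq_abs, Real.norm_eq_abs,
          abs_of_nonneg (Real.sqrt_nonneg _)]
        simpa using this)
      simpa [krausSeq, ofNumber, annihilation, mul_assoc] using this
    refine (Finset.sum_le_sum h).trans ?_
    have := sum_sq_le x (s.map ⟨fun n => n + 1, add_left_injective 1⟩)
    simpa using this
  | (true, false) =>
    have h : ∀ n ∈ s, ‖p.krausSeq (true, false) x n‖ ^ 2 ≤
        if n = 0 then 0 else ‖x (n - 1)‖ ^ 2 := by
      intro n _
      split_ifs with hn
      · subst hn; simp [krausSeq, ofNumber, creation]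
      have := key true n ((p.S n : ℂ) * (√(n : ℝ) : ℂ)) (x (n - 1)) (by
        have := p.norm_S_le n
        rw [norm_mul, Complex.norm_real, Complex.norm_real, Real.norm_eq_abs, Real.norm_eq_abs,
          abs_of_nonneg (Real.sqrt_nonneg _)]
        simpa using this)
      simpa [krausSeq, ofNumber, creation, mul_assoc] using this
    refine (Finset.sum_le_sum h).trans ?_
    rw [Finset.sum_ite, Finset.sum_const_zero, zero_add]
    have hi : Set.InjOn (fun n : ℕ => n - 1) (s.filter fun n => ¬ n = 0) := by
      intro a ha b hb hab
      simp at ha hb hab; omega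
    have := sum_sq_le x ((s.filter fun n => ¬ n = 0).image fun n => n - 1)
    rwa [Finset.sum_image hi] at this

/-- The Kraus operators `V_{σσ'}`. -/
def V (y : Outcome) : Op := contraction (p.krausSeq y) (p.krausSeq_bound y)

/-- The product `V_{ζ_s} ⋯ V_{ζ_1}` associated with a word `ζ_1, …, ζ_s`. -/
def wordOp (w : List Outcome) : Op := w.foldl (fun A y => p.V y * A) 1

/-- `W_t(ω) = V_{ω_t} ⋯ V_{ω_1}`. -/
def W (t : ℕ) (ω : Omega) : Op := p.wordOp ((List.range t).map ω)

/-- The unnormalized Gibbs state `e^{-βεN}`. -/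
def gibbs : Op := contraction (ofNumber fun n => (Real.exp (-p.beta * p.eps * n) : ℂ)) (by
  intro x s
  refine (Finset.sum_le_sum fun n _ => ?_).trans (sum_sq_le x s)
  have h : ‖(Real.exp (-p.beta * p.eps * n) : ℂ)‖ ≤ 1 := by
    rw [Complex.norm_real, Real.norm_eq_abs, abs_of_nonneg (Real.exp_pos _).le, Real.exp_le_one_iff]
    have : 0 ≤ p.beta * p.eps * n := by
      have := p.beta_pos; have := p.eps_pos; positivity
    linarith
  have h2 : ‖(Real.exp (-p.beta * p.eps * n) : ℂ) * x n‖ ≤ ‖x n‖ := by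
    rw [norm_mul]
    exact mul_le_of_le_one_left (norm_nonneg _) h
  exact pow_le_pow_left₀ (norm_nonneg _) h2 2)

/-- The invariant state `ρ_inv = e^{-βεN} / Tr(e^{-βεN})`. -/
def rhoInv : Op := (tr p.gibbs)⁻¹ • p.gibbs

/-! ### The law of the outcomes -/

lemma wordOp_append (w : List Outcome) (y : Outcome) :
    p.wordOp (w ++ [y]) = p.V y * p.wordOp w := by
  simp [wordOp]

lemma V_mm_fock (n : ℕ) : p.V (false, false) (fock n) =
    (√(p.pAt false) * (p.phase n * p.C n) : ℂ) • fock n := by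
  apply lp.ext; funext m
  by_cases h : m = n
  · subst h; simp [V, krausSeq, ofNumber, fock, lp.coeFn_smul]
  · simp [V, krausSeq, ofNumber, fock, lp.coeFn_smul, h]

lemma V_pp_fock (n : ℕ) : p.V (true, true) (fock n) =
    (√(p.pAt true) * (p.phase n * star (p.C (n + 1))) : ℂ) • fock n := by
  apply lp.ext; funext m
  by_cases h : m = n
  · subst h; simp [V, krausSeq, ofNumber, fock, lp.coeFn_smul]
  · simp [V, krausSeq, ofNumber, fock, lp.coeFn_smul, h]

lemma V_mp_fock (n : ℕ) : p.V (false, true) (fock n) =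
    (√(p.pAt false) * (p.phase (n - 1) * (p.S n * √(n : ℝ))) : ℂ) • fock (n - 1) := by
  apply lp.ext; funext m
  rcases n with _ | n
  · simp [V, krausSeq, ofNumber, annihilation, fock]
  · by_cases h : m = n
    · subst h; simp [V, krausSeq, ofNumber, annihilation, fock, lp.coeFn_smul]
    · simp [V, krausSeq, ofNumber, annihilation, fock, lp.coeFn_smul, h]

lemma V_pm_fock (n : ℕ) : p.V (true, false) (fock n) =
    (√(p.pAt true) * (p.phase (n + 1) * (p.S (n + 1) * √((n : ℝ) + 1))) : ℂ) • fock (n + 1) := by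
  apply lp.ext; funext m
  rcases m with _ | m
  · simp [V, krausSeq, ofNumber, creation, fock, lp.coeFn_smul]
  · by_cases h : m = n
    · subst h; simp [V, krausSeq, ofNumber, creation, fock, lp.coeFn_smul]
    · simp [V, krausSeq, ofNumber, creation, fock, lp.coeFn_smul, h]

lemma V_fock (y : Outcome) : ∃ s : ℤ, ∀ n, ∃ (c : ℂ) (k : ℕ),
    p.V y (fock n) = c • fock k ∧ (c ≠ 0 → (k : ℤ) = n + s) := by
  match y with
  | (false, false) => exact ⟨0, fun n => ⟨_, _, p.V_mm_fock n, by simp⟩⟩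
  | (true, true) => exact ⟨0, fun n => ⟨_, _, p.V_pp_fock n, by simp⟩⟩
  | (false, true) =>
    refine ⟨-1, fun n => ⟨_, _, p.V_mp_fock n, ?_⟩⟩
    intro h
    rcases n with _ | n
    · simp at h
    · push_cast; simp
  | (true, false) => exact ⟨1, fun n => ⟨_, _, p.V_pm_fock n, by simp⟩⟩

lemma wordOp_fock (w : List Outcome) : ∃ s : ℤ, ∀ n, ∃ (c : ℂ) (k : ℕ),
    p.wordOp w (fock n) = c • fock k ∧ (c ≠ 0 → (k : ℤ) = n + s) := by
  induction w using List.reverseRecOn with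
  | nil => exact ⟨0, fun n => ⟨1, n, by simp [wordOp], by simp⟩⟩
  | append_singleton w y ih =>
    obtain ⟨s, hs⟩ := ih
    obtain ⟨r, hr⟩ := p.V_fock y
    refine ⟨s + r, fun n => ?_⟩
    obtain ⟨c, k, h1, h2⟩ := hs n
    obtain ⟨d, l, h3, h4⟩ := hr k
    refine ⟨c * d, l, ?_, fun h => ?_⟩
    · rw [wordOp_append, mul_apply_eq_comp, h1, map_smul, h3, smul_smul]
    · rw [h4 (right_ne_zero_of_mul h), h2 (left_ne_zero_of_mul h), add_assoc]

lemma sum_norm_V_fock (n : ℕ) : ∑ y, ‖p.V y (fock n)‖ ^ 2 = 1 := by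
  have e := p.pAt_add
  have h1 := p.normSq_C_add n
  have h2 := p.normSq_C_add (n + 1)
  have hf := p.pAt_nonneg false
  have ht := p.pAt_nonneg true
  have hn : (0 : ℝ) ≤ n := n.cast_nonneg
  have hn1 : (0 : ℝ) ≤ (n : ℝ) + 1 := by positivity
  push_cast at h2
  rw [Fintype.sum_prod_type]
  simp only [Fintype.sum_bool, V_mm_fock, V_pp_fock, V_mp_fock, V_pm_fock, norm_smul, norm_mul,
    norm_phase, norm_fock, Complex.norm_real, Real.norm_eq_abs, norm_star, mul_one, one_mul, mul_pow,
    sq_abs, Real.sq_sqrt hf, Real.sq_sqrt ht, Real.sq_sqrt hn, Real.sq_sqrt hn1]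
  linear_combination p.pAt true * h2 + p.pAt false * h1 + e

lemma sum_norm_wordOp (w : List Outcome) (n : ℕ) :
    ∑ y, ‖p.wordOp (w ++ [y]) (fock n)‖ ^ 2 = ‖p.wordOp w (fock n)‖ ^ 2 := by
  obtain ⟨s, hs⟩ := p.wordOp_fock w
  obtain ⟨c, k, h, -⟩ := hs n
  simp only [wordOp_append, mul_apply_eq_comp, h, map_smul, norm_smul, mul_pow,
    ← Finset.mul_sum, sum_norm_V_fock, norm_fock, one_pow]

lemma star_wordOp_mul_fock (w : List Outcome) (n : ℕ) :
    (star (p.wordOp w) * p.wordOp w) (fock n) = ((‖p.wordOp w (fock n)‖ ^ 2 : ℝ) : ℂ) • fock n := by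
  apply lp.ext; funext m
  rw [← inner_fock m, ← inner_fock m, mul_apply_eq_comp,
    ContinuousLinearMap.star_eq_adjoint, ContinuousLinearMap.adjoint_inner_right, inner_smul_right]
  by_cases hm : m = n
  · subst hm
    rw [inner_self_eq_norm_sq_to_K, inner_self_eq_norm_sq_to_K, norm_fock]
    simp
  · rw [inner_fock m (fock n)]
    obtain ⟨s, hs⟩ := p.wordOp_fock w
    obtain ⟨c, k, h1, h2⟩ := hs n
    obtain ⟨d, l, h3, h4⟩ := hs m
    rw [h1, h3, inner_smul_left, inner_smul_right, inner_fock]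
    have h0 : fock n m = 0 := by simp [fock, hm]
    rw [h0, mul_zero]
    by_cases hc : c = 0
    · simp [hc]
    by_cases hd : d = 0
    · simp [hd]
    have hkl : l ≠ k := by
      have := h2 hc; have := h4 hd; omega
    simp [fock, hkl]

lemma tr_wordOp (ρ : Op) (w : List Outcome) : tr (ρ * (star (p.wordOp w) * p.wordOp w)) =
    ∑' n, ((‖p.wordOp w (fock n)‖ ^ 2 : ℝ) : ℂ) * inner ℂ (fock n) (ρ (fock n)) := by
  unfold tr
  congr 1; funext n
  rw [mul_apply_eq_comp, star_wordOp_mul_fock, map_smul, inner_smul_right]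

lemma norm_wordOp_fock_le (w : List Outcome) (n : ℕ) : ‖p.wordOp w (fock n)‖ ^ 2 ≤ 1 := by
  induction w using List.reverseRecOn with
  | nil => simp [wordOp, norm_fock]
  | append_singleton w y ih =>
    refine le_trans ?_ ih
    rw [← p.sum_norm_wordOp w n]
    exact Finset.single_le_sum (f := fun y => ‖p.wordOp (w ++ [y]) (fock n)‖ ^ 2)
      (fun _ _ => by positivity) (Finset.mem_univ y)

/-- `μ` is the law of the outcomes for the initial state `ρ`: a probability measure which gives the
cylinder set of the first outcomes `ω_1, …, ω_t` the probability `Tr(ρ W_t(ω)* W_t(ω))`. Since these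
sets generate the `σ`-algebra, there is only one such measure. -/
def IsOutcomeLaw (ρ : State) (μ : Measure Omega) : Prop :=
  IsProbabilityMeasure μ ∧ ∀ (ω : Omega) (t : ℕ),
    (μ.real {z | ∀ i < t, z i = ω i} : ℂ) = tr (ρ.op * (star (p.W t ω) * p.W t ω))

theorem exists_isOutcomeLaw (ρ : State) : ∃ μ, p.IsOutcomeLaw ρ μ := by
  have hpos : ∀ n, 0 ≤ inner ℂ (fock n) (ρ.op (fock n)) := fun n => ρ.isPositive.inner_nonneg_right _
  let d : ℕ → ℝ := fun n => (inner ℂ (fock n) (ρ.op (fock n))).re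
  have hd : ∀ n, inner ℂ (fock n) (ρ.op (fock n)) = (d n : ℂ) := fun n =>
    Complex.eq_re_of_ofReal_le (hpos n)
  have hd0 : ∀ n, 0 ≤ d n := fun n => (Complex.nonneg_iff.1 (hpos n)).1
  have h1 : ∑' n, d n = 1 := by
    have := ρ.trace_one
    simp only [tr, hd] at this
    exact_mod_cast this
  have hs : Summable d := by
    by_contra h
    rw [tsum_eq_zero_of_not_summable h] at h1
    exact zero_ne_one h1
  let q : List Outcome → ℝ := fun w => ∑' n, ‖p.wordOp w (fock n)‖ ^ 2 * d n
  have hq : ∀ w, tr (ρ.op * (star (p.wordOp w) * p.wordOp w)) = (q w : ℂ) := by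
    intro w
    rw [tr_wordOp]
    simp only [hd, q]
    push_cast
    rfl
  have hqs : ∀ w, Summable fun n => ‖p.wordOp w (fock n)‖ ^ 2 * d n := fun w =>
    hs.of_nonneg_of_le (fun n => mul_nonneg (by positivity) (hd0 n))
      (fun n => mul_le_of_le_one_left (hd0 n) (p.norm_wordOp_fock_le w n))
  have hq0 : ∀ w, 0 ≤ q w := fun w => tsum_nonneg fun n => mul_nonneg (by positivity) (hd0 n)
  have hsum : ∀ w, ∑ y, q (w ++ [y]) = q w := by
    intro w
    simp only [q]
    rw [← Summable.tsum_finsetSum fun y _ => hqs _]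
    congr 1; funext n
    rw [← Finset.sum_mul, sum_norm_wordOp]
  obtain ⟨μ, hμ, h⟩ := exists_measure_of_consistent (fun w => ENNReal.ofReal (q w))
    (by simp [q, wordOp, norm_fock, h1])
    (fun w => by rw [← ENNReal.ofReal_sum_of_nonneg fun y _ => hq0 _, hsum])
  refine ⟨μ, hμ, fun ω t => ?_⟩
  rw [Measure.real, h ω t, ENNReal.toReal_ofReal (hq0 _), W, hq]

/-- The law `ℙ^ρ` of the sequence of outcomes for the initial state `ρ`. -/
def law (ρ : State) : Measure Omega := (p.exists_isOutcomeLaw ρ).choose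

/-! ### The trajectory and the martingale -/

/-- The quantum trajectory `ρ_t = W_t ρ W_t* / Tr(W_t ρ W_t*)`. The denominator is nonzero
`ℙ^ρ`-almost surely. -/
def traj (ρ : State) (t : ℕ) (ω : Omega) : Op :=
  (tr (p.W t ω * ρ.op * star (p.W t ω)))⁻¹ • (p.W t ω * ρ.op * star (p.W t ω))

/-- `M_t = ρ_inv^{1/2} W_t* W_t ρ_inv^{1/2} / Tr(W_t* W_t ρ_inv)`. The denominator is nonzero
`ℙ^ρ`-almost surely for every state `ρ`. -/
def M (t : ℕ) (ω : Omega) : Op :=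
  (tr (star (p.W t ω) * p.W t ω * p.rhoInv))⁻¹ •
    (opSqrt p.rhoInv * (star (p.W t ω) * p.W t ω) * opSqrt p.rhoInv)

/-- `M_t(ω)` converges to `X` in trace norm as `t → ∞`. -/
def MTendsto (ω : Omega) (X : Op) : Prop :=
  Tendsto (fun t => traceNorm (p.M t ω - X)) atTop (𝓝 0)

open Classical in
/-- `M_∞`, the limit in trace norm of `M_t` (and `0`, which is not a state, where there is no such
limit). -/
def MInf (ω : Omega) : Op := if h : ∃ X, p.MTendsto ω X then h.choose else 0

/-- The Fock states with index in `𝒩` give the same probability to every nonempty finite word of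
outcomes. -/
def Indistinguishable (𝒩 : Set ℕ) : Prop :=
  ∀ n ∈ 𝒩, ∀ m ∈ 𝒩, ∀ w : List Outcome, w ≠ [] →
    ‖p.wordOp w (fock m)‖ ^ 2 = ‖p.wordOp w (fock n)‖ ^ 2

end Params

/-- The orthogonal projection onto the closed subspace spanned by `{|n⟩ : n ∈ 𝒩}`. -/
def fockProj (𝒩 : Set ℕ) : Op := (Submodule.span ℂ (fock '' 𝒩)).topologicalClosure.starProjection

/-- The infimum of `‖A - |φ⟩⟨φ|‖₁` over the unit vectors `φ`. -/
def distPure (A : Op) : ℝ≥0∞ :=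
  ⨅ (φ : Fock) (_ : ‖φ‖ = 1), traceNorm (A - InnerProductSpace.rankOne ℂ φ φ)

end Maser
end

noncomputable section

namespace Maser

/-! ### Square roots and absolute values of operators -/

section Hilbert

variable {H : Type*} [NormedAddCommGroup H] [InnerProductSpace ℂ H] [CompleteSpace H]

/-! Every Kraus operator sends each Fock vector to a multiple of a Fock vector, and wherever the
amplitude is nonzero the displacement depends on the outcome only. Hence `W_t* W_t` is diagonal in
the Fock basis. Its entry at `n` is the probability of the observed word when the cavity starts in
`|n⟩`. The law of the outcomes for `ρ` is therefore the mixture of the laws `P_n` (`fockLaw n`)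
weighted by the diagonal of `ρ` (`law_eq_sum`), and `M_t` is diagonal with Bayes' posterior for the
initial level, with the Gibbs weights as prior (`isDiag_M`). The asymptotics of `M_t` reduce to
identifying `n` from one infinite sequence of outcomes.

By Lévy's upward theorem the posteriors converge to Gibbs weights times the densities of the `P_m`
with respect to the Gibbs mixture. What remains is a dichotomy: `P_n` and `P_m` are either equal or
mutually singular (`ae_density_eq_zero`). It rests on recurrence alone, so Rabi resonances play no
role. Detailed balance makes the pair (current level, future outcomes) stationary under the Gibbs
law (`measurePreserving_shift`), and Poincaré recurrence brings the motion back to `n`, infinitely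
often with any event of the future recurring. Where the density of `P_m` is positive under `P_n`,
the likelihood ratio of `m` to `n` has a finite positive limit. At a return followed by a repetition
of the initial word `u` it gets multiplied by the ratio for `u`, which must then be `1`
(`ae_prob_eq_of_density_ne_zero`). So the two probabilities agree along every prefix. A zero-one
law, again from recurrence (`ae_prob_eq_of_measure_ne_zero`), makes this almost sure if it has
positive probability, and then the two laws coincide (`prob_eq_of_ae`).

Under `P_n` the limiting posterior is thus the Gibbs distribution conditioned on the class of `n`.
Scheffé's lemma turns entrywise convergence into trace norm convergence (`ae_mTendsto_condState`),
and summing over `n` gives `Tr(ρQ)`.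

For two levels of one class, the equal mixture never purifies: each possible word moves both levels
by the same displacement with the same probability. The trajectory stays an equal mixture of two
distinct Fock states, at distance one from the pure states (`distPure_pair`). -/

lemma opSqrt_mul_self {A : H →L[ℂ] H} (hA : 0 ≤ A) : opSqrt A * opSqrt A = A :=
  CFC.sqrt_mul_sqrt_self A hA

lemma opSqrt_unique {A B : H →L[ℂ] H} (h : B * B = A) (hB : 0 ≤ B) : opSqrt A = B :=
  CFC.sqrt_unique h hB

lemma star_opSqrt (A : H →L[ℂ] H) : star (opSqrt A) = opSqrt A :=
  (CFC.sqrt_nonneg A).isSelfAdjoint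

lemma opAbs_nonneg (A : H →L[ℂ] H) : 0 ≤ opAbs A := CFC.sqrt_nonneg _

lemma norm_opAbs (A : H →L[ℂ] H) : ‖opAbs A‖ = ‖A‖ := CFC.norm_abs

lemma opAbs_sub_nonneg {A : H →L[ℂ] H} (hA : IsSelfAdjoint A) : 0 ≤ opAbs A - A := by
  have h : opAbs A - A = 2 • A⁻ := CFC.abs_sub_self A hA
  rw [h]; exact nsmul_nonneg (CFC.negPart_nonneg A) 2

lemma opAbs_add_nonneg {A : H →L[ℂ] H} (hA : IsSelfAdjoint A) : 0 ≤ opAbs A + A := by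
  have h : opAbs A + A = 2 • A⁺ := CFC.abs_add_self A hA
  rw [h]; exact nsmul_nonneg (CFC.posPart_nonneg A) 2

lemma opSqrt_mul_opSqrt_inner {A : H →L[ℂ] H} (hA : 0 ≤ A) (x : H) :
    (inner ℂ x (A x)).re = ‖opSqrt A x‖ ^ 2 := by
  conv_lhs => rw [← opSqrt_mul_self hA, mul_apply_eq_comp]
  nth_rw 1 [← star_opSqrt A]
  rw [ContinuousLinearMap.star_eq_adjoint, ContinuousLinearMap.adjoint_inner_right,
    inner_self_eq_norm_sq_to_K]
  norm_cast

lemma norm_eq_sq_norm_opSqrt_opAbs (A : H →L[ℂ] H) :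
    ‖A‖ = ‖opSqrt (opAbs A)‖ * ‖opSqrt (opAbs A)‖ := by
  rw [← norm_opAbs A]
  conv_lhs => rw [← opSqrt_mul_self (opAbs_nonneg A)]
  nth_rw 1 [← star_opSqrt (opAbs A)]
  exact CStarRing.norm_star_mul_self

lemma isSelfAdjoint_sub_rankOne {A : H →L[ℂ] H} (hA : IsSelfAdjoint A) (x : H) :
    IsSelfAdjoint (A - InnerProductSpace.rankOne ℂ x x) := by
  refine hA.sub ?_
  rw [isSelfAdjoint_iff, ContinuousLinearMap.star_eq_adjoint, InnerProductSpace.adjoint_rankOne]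

end Hilbert

/-! ### Operators diagonal in the Fock basis -/

/-- `A` is diagonal in the Fock basis, with eigenvalues `d`. -/
def IsDiag (A : Op) (d : ℕ → ℂ) : Prop := ∀ n, A (fock n) = d n • fock n

lemma op_ext {A B : Op} (h : ∀ n, A (fock n) = B (fock n)) : A = B := by
  apply lp.ext_continuousLinearMap (by simp)
  intro n
  refine ContinuousLinearMap.ext_ring ?_
  exact h n

lemma inner_fock_fock (m n : ℕ) : inner ℂ (fock m) (fock n) = if m = n then (1 : ℂ) else 0 := by
  rw [inner_fock]
  simp [fock, Pi.single_apply]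

lemma inner_fock_self (n : ℕ) : inner ℂ (fock n) (fock n) = (1 : ℂ) := by
  rw [inner_fock_fock, if_pos rfl]

lemma fock_ext {x y : Fock} (h : ∀ n, inner ℂ (fock n) x = inner ℂ (fock n) y) : x = y := by
  apply lp.ext; funext n
  simpa only [inner_fock] using h n

lemma sum_ofReal_sq_inner_fock (x : Fock) :
    ∑' n, ENNReal.ofReal (‖inner ℂ (fock n) x‖ ^ 2) = ENNReal.ofReal (‖x‖ ^ 2) := by
  have h := lp.hasSum_norm (p := 2) (by simp) x
  simp only [ENNReal.toReal_ofNat, Real.rpow_ofNat] at h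
  simp only [inner_fock]
  rw [← ENNReal.ofReal_tsum_of_nonneg (fun n => by positivity) h.summable, h.tsum_eq]

namespace IsDiag

variable {A B : Op} {d e : ℕ → ℂ}

lemma ext (hA : IsDiag A d) (hB : IsDiag B d) : A = B :=
  op_ext fun n => by rw [hA, hB]

lemma mul (hA : IsDiag A d) (hB : IsDiag B e) : IsDiag (A * B) (fun n => d n * e n) := fun n => by
  rw [mul_apply_eq_comp, hB, map_smul, hA, smul_smul, mul_comm]

lemma sub (hA : IsDiag A d) (hB : IsDiag B e) : IsDiag (A - B) (fun n => d n - e n) := fun n => by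
  rw [sub_apply, hA, hB, sub_smul]

lemma smul (hA : IsDiag A d) (c : ℂ) : IsDiag (c • A) (fun n => c * d n) := fun n => by
  rw [smul_apply, hA, smul_smul]

lemma star (hA : IsDiag A d) : IsDiag (star A) (fun n => star (d n)) := fun n => by
  apply fock_ext; intro m
  rw [ContinuousLinearMap.star_eq_adjoint, ContinuousLinearMap.adjoint_inner_right, hA,
    inner_smul_left, inner_smul_right, inner_fock_fock]
  split_ifs with h
  · subst h; simp
  · simp

lemma inner_fock_apply (hA : IsDiag A d) (n : ℕ) : inner ℂ (fock n) (A (fock n)) = d n := by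
  rw [hA, inner_smul_right, inner_fock_self, mul_one]

lemma norm_le (hA : IsDiag A d) (n : ℕ) : ‖d n‖ ≤ ‖A‖ := by
  have := A.le_opNorm (fock n)
  rwa [hA, norm_smul, norm_fock, mul_one, mul_one] at this

lemma tr_eq (hA : IsDiag A d) : tr A = ∑' n, d n := by
  unfold tr; congr 1; funext n; exact hA.inner_fock_apply n

end IsDiag

lemma exists_isDiag (d : ℕ → ℂ) (c : ℝ) (h : ∀ n, ‖d n‖ ≤ c) : ∃ A, IsDiag A d := by
  rcases (norm_nonneg _ |>.trans (h 0)).eq_or_lt with hc | hc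
  · refine ⟨0, fun n => ?_⟩
    have : d n = 0 := norm_le_zero_iff.1 ((h n).trans hc.symm.le)
    simp [this]
  -- The basic construction gives contractions only, so the eigenvalues are first divided by their
  -- bound.
  · refine ⟨(c : ℂ) • contraction (ofNumber fun n => d n / c) ?_, fun n => ?_⟩
    · intro x s
      refine (Finset.sum_le_sum fun n _ => ?_).trans (sum_sq_le x s)
      gcongr
      change ‖d n / c * x n‖ ≤ _
      rw [norm_mul, norm_div, Complex.norm_real, Real.norm_eq_abs, abs_of_pos hc]
      exact mul_le_of_le_one_left (norm_nonneg _) ((div_le_one hc).2 (h n))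
    · apply lp.ext; funext m
      have hc' : (c : ℂ) ≠ 0 := by exact_mod_cast hc.ne'
      rw [_root_.smul_apply, lp.coeFn_smul, lp.coeFn_smul, Pi.smul_apply, Pi.smul_apply,
        contraction_apply]
      change (c : ℂ) * (d m / c * fock n m) = d n * fock n m
      by_cases hm : m = n
      · subst hm; field_simp
      · simp [fock, hm]

lemma IsDiag.nonneg {A : Op} {d : ℕ → ℝ} (hA : IsDiag A fun n => (d n : ℂ)) (hd : ∀ n, 0 ≤ d n) :
    0 ≤ A := by
  obtain ⟨R, hR⟩ := exists_isDiag (fun n => (√(d n) : ℂ)) √‖A‖ fun n => by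
    rw [Complex.norm_real, Real.norm_eq_abs, abs_of_nonneg (Real.sqrt_nonneg _)]
    apply Real.sqrt_le_sqrt
    simpa [abs_of_nonneg (hd n)] using hA.norm_le n
  have : A = Star.star R * R := by
    refine hA.ext ?_
    convert hR.star.mul hR using 2 with n
    simp only [Complex.star_def, Complex.conj_ofReal]
    norm_cast
    rw [Real.mul_self_sqrt (hd n)]
  rw [this]
  exact star_mul_self_nonneg R

/-- The diagonal operator with entries `√(d n)` is positive and squares to `A`; uniqueness of the
positive root identifies the two. -/
lemma IsDiag.opSqrt {A : Op} {d : ℕ → ℝ} (hA : IsDiag A fun n => (d n : ℂ)) (hd : ∀ n, 0 ≤ d n) :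
    IsDiag (opSqrt A) fun n => (√(d n) : ℂ) := by
  obtain ⟨R, hR⟩ := exists_isDiag (fun n => (√(d n) : ℂ)) √‖A‖ fun n => by
    rw [Complex.norm_real, Real.norm_eq_abs, abs_of_nonneg (Real.sqrt_nonneg _)]
    apply Real.sqrt_le_sqrt
    simpa [abs_of_nonneg (hd n)] using hA.norm_le n
  have h0 : 0 ≤ R := hR.nonneg fun n => Real.sqrt_nonneg _
  have : R * R = A := by
    refine IsDiag.ext (d := fun n => (d n : ℂ)) ?_ hA
    convert hR.mul hR using 2 with n
    norm_cast
    rw [Real.mul_self_sqrt (hd n)]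
  rw [opSqrt_unique this h0]
  exact hR

lemma IsDiag.opAbs {A : Op} {d : ℕ → ℂ} (hA : IsDiag A d) :
    IsDiag (opAbs A) fun n => (‖d n‖ : ℂ) := by
  have h : IsDiag (Star.star A * A) fun n => ((‖d n‖ ^ 2 : ℝ) : ℂ) := by
    convert hA.star.mul hA using 2 with n
    push_cast
    exact (Complex.conj_mul' _).symm
  have := h.opSqrt fun n => by positivity
  simp only [Real.sqrt_sq (norm_nonneg _)] at this
  exact this

lemma IsDiag.traceNorm_eq {A : Op} {d : ℕ → ℂ} (hA : IsDiag A d) :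
    traceNorm A = ∑' n, ENNReal.ofReal ‖d n‖ := by
  unfold traceNorm; congr 1; funext n
  rw [hA.opAbs.inner_fock_apply, Complex.ofReal_re]

/-! ### The trace norm -/

/-- With `R = B^{1/2}`, Parseval gives `⟨x, Bx⟩ = ‖Rx‖² = ∑ |⟨R e_n, x⟩|²`, and Cauchy–Schwarz
bounds the terms by `‖R e_n‖² = ⟨e_n, B e_n⟩`. -/
lemma inner_le_sum_diag {B : Op} (hB : 0 ≤ B) {x : Fock} (hx : ‖x‖ ≤ 1) :
    ENNReal.ofReal (inner ℂ x (B x)).re ≤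
      ∑' n, ENNReal.ofReal (inner ℂ (fock n) (B (fock n))).re := by
  simp only [opSqrt_mul_opSqrt_inner hB]
  rw [← sum_ofReal_sq_inner_fock]
  refine ENNReal.tsum_le_tsum fun n => ENNReal.ofReal_le_ofReal ?_
  have : inner ℂ (fock n) (opSqrt B x) = inner ℂ (opSqrt B (fock n)) x := by
    nth_rw 1 [← star_opSqrt B]
    rw [ContinuousLinearMap.star_eq_adjoint, ContinuousLinearMap.adjoint_inner_right]
  rw [this]
  gcongr
  exact (norm_inner_le_norm _ _).trans (mul_le_of_le_one_right (norm_nonneg _) hx)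

/-- For `R = |A|^{1/2}` one has `‖A‖ = ‖R‖²` and `‖Rx‖² = ⟨x, |A|x⟩ ≤ Tr |A|` on unit vectors.
Through this bound limits in trace norm are unique. -/
lemma norm_le_traceNorm (A : Op) : ENNReal.ofReal ‖A‖ ≤ traceNorm A := by
  by_cases h : traceNorm A = ∞
  · simp [h]
  have h2 : ‖opSqrt (opAbs A)‖ ≤ √(traceNorm A).toReal := by
    refine ContinuousLinearMap.opNorm_le_of_unit_norm (Real.sqrt_nonneg _) fun x hx =>
      Real.le_sqrt_of_sq_le ?_
    have h3 := inner_le_sum_diag (opAbs_nonneg A) hx.le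
    rw [opSqrt_mul_opSqrt_inner (opAbs_nonneg A)] at h3
    exact (ENNReal.ofReal_le_iff_le_toReal h).1 h3
  refine (ENNReal.ofReal_le_iff_le_toReal h).2 ?_
  rw [norm_eq_sq_norm_opSqrt_opAbs,
    ← Real.mul_self_sqrt (ENNReal.toReal_nonneg (a := traceNorm A))]
  gcongr

lemma tendsto_of_tendsto_traceNorm {f : ℕ → Op} {X : Op}
    (h : Tendsto (fun t => traceNorm (f t - X)) atTop (𝓝 0)) : Tendsto f atTop (𝓝 X) := by
  rw [tendsto_iff_norm_sub_tendsto_zero]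
  have := tendsto_of_tendsto_of_tendsto_of_le_of_le tendsto_const_nhds h
    (fun _ => zero_le) (fun t => norm_le_traceNorm (f t - X))
  have h2 := (ENNReal.tendsto_toReal ENNReal.zero_ne_top).comp this
  simpa [Function.comp_def] using h2

/-! ### Projections and the distance to pure states -/

lemma isDiag_fockProj (𝒩 : Set ℕ) : IsDiag (fockProj 𝒩) (𝒩.indicator 1) := by
  intro n
  unfold fockProj
  by_cases hn : n ∈ 𝒩
  · rw [Set.indicator_of_mem hn, Pi.one_apply, one_smul]
    rw [Submodule.starProjection_eq_self_iff]
    exact Submodule.le_topologicalClosure _ (Submodule.subset_span ⟨n, hn, rfl⟩)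
  · rw [Set.indicator_of_notMem hn, zero_smul, Submodule.starProjection_apply_eq_zero_iff,
      Submodule.orthogonal_closure, Submodule.mem_orthogonal]
    intro u hu
    induction hu using Submodule.span_induction with
    | mem x hx =>
      obtain ⟨m, hm, rfl⟩ := hx
      rw [inner_fock_fock, if_neg]
      rintro rfl; exact hn hm
    | zero => simp
    | add x y _ _ hx hy => rw [inner_add_left, hx, hy, add_zero]
    | smul c x _ hx => rw [inner_smul_left, hx, mul_zero]

/-- Since `Tr A = 0`, the positive operator `|A| - A` has trace `‖A‖₁`, which bounds `⟨x, (|A| -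
A)x⟩`; and `|A| ≥ -A` makes this at least `-2⟨x, Ax⟩`. -/
lemma neg_inner_le_traceNorm {A : Op} (hA : IsSelfAdjoint A)
    (htr : HasSum (fun n => inner ℂ (fock n) (A (fock n))) 0) {x : Fock} (hx : ‖x‖ ≤ 1) :
    ENNReal.ofReal (-2 * (inner ℂ x (A x)).re) ≤ traceNorm A := by
  by_cases hT : traceNorm A = ∞
  · simp [hT]
  have hneg := opAbs_sub_nonneg hA
  have hpos := opAbs_add_nonneg hA
  have hre : ∀ {B : Op}, 0 ≤ B → ∀ y, 0 ≤ (inner ℂ y (B y)).re := fun hB y =>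
    (Complex.nonneg_iff.1 (((ContinuousLinearMap.nonneg_iff_isPositive _).1 hB).inner_nonneg_right y)).1
  have e1 := inner_le_sum_diag hneg hx
  have hs : Summable fun n => (inner ℂ (fock n) (opAbs A (fock n))).re := by
    have := ENNReal.summable_toReal hT
    refine this.congr fun n => ?_
    rw [ENNReal.toReal_ofReal (hre (opAbs_nonneg A) _)]
  have hA0 : HasSum (fun n => (inner ℂ (fock n) (A (fock n))).re) 0 := by
    simpa using Complex.hasSum_re htr
  have e2 : ∑' n, ENNReal.ofReal (inner ℂ (fock n) ((opAbs A - A) (fock n))).re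
      = traceNorm A := by
    have h3 : ∀ n, (inner ℂ (fock n) ((opAbs A - A) (fock n))).re =
        (inner ℂ (fock n) (opAbs A (fock n))).re - (inner ℂ (fock n) (A (fock n))).re := by
      intro n; rw [sub_apply, inner_sub_right, Complex.sub_re]
    have h4 := hs.hasSum.sub hA0
    rw [← ENNReal.ofReal_tsum_of_nonneg (fun n => hre hneg _) (h4.summable.congr fun n => (h3 n).symm)]
    simp only [h3]
    rw [h4.tsum_eq, sub_zero, ENNReal.ofReal_tsum_of_nonneg (fun n => hre (opAbs_nonneg A) _) hs]
    rfl
  rw [e2] at e1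
  refine le_trans (ENNReal.ofReal_le_ofReal ?_) e1
  have e3 := hre hpos x
  rw [add_apply, inner_add_right, Complex.add_re] at e3
  rw [sub_apply, inner_sub_right, Complex.sub_re]
  linarith

lemma sum_sq_pair_le {a b : ℕ} (hab : a ≠ b) (x : Fock) : ‖x a‖ ^ 2 + ‖x b‖ ^ 2 ≤ ‖x‖ ^ 2 := by
  have := sum_sq_le x {a, b}
  rwa [Finset.sum_pair hab] at this

/-- The equal mixture of two distinct Fock states is at distance one from the pure states. -/
lemma distPure_pair {A : Op} {a b : ℕ} (hab : a ≠ b)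
    (hA : IsDiag A (fun n => if n = a ∨ n = b then (1 / 2 : ℂ) else 0)) : distPure A = 1 := by
  apply le_antisymm
  · refine (iInf₂_le (fock a) (norm_fock a)).trans ?_
    have hr : IsDiag (InnerProductSpace.rankOne ℂ (fock a) (fock a))
        (fun n => if n = a then 1 else 0) := by
      intro n
      rw [InnerProductSpace.rankOne_apply, inner_fock_fock]
      by_cases h : n = a
      · simp [h]
      · simp [h, Ne.symm h]
    rw [(hA.sub hr).traceNorm_eq, tsum_eq_sum (s := {a, b})]
    · rw [Finset.sum_pair hab]
      simp only [true_or, if_true, or_true, if_neg hab.symm, sub_zero]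
      norm_num
      rw [← ENNReal.ofReal_add (by norm_num) (by norm_num)]
      norm_num
    · intro n hn
      simp only [Finset.mem_insert, Finset.mem_singleton, not_or] at hn
      simp [hn.1, hn.2]
  -- Lower bound: `A - |φ⟩⟨φ|` has zero trace, and testing it on `φ` itself gives at most `1/2 - 1 =
  -- -1/2`.
  · refine le_iInf₂ fun φ hφ => ?_
    have hsa : IsSelfAdjoint A := by
      refine hA.star.ext ?_
      convert hA using 2 with n
      split_ifs <;> simp
    have hsB : IsSelfAdjoint (A - InnerProductSpace.rankOne ℂ φ φ) :=
      isSelfAdjoint_sub_rankOne hsa φ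
    have htr : HasSum (fun n => inner ℂ (fock n)
        ((A - InnerProductSpace.rankOne ℂ φ φ) (fock n))) 0 := by
      have h1 : HasSum (fun n => inner ℂ (fock n) (A (fock n))) 1 := by
        simp only [hA.inner_fock_apply]
        have : HasSum (fun n => if n = a ∨ n = b then (1 / 2 : ℂ) else 0) _ :=
          hasSum_sum_of_ne_finset_zero (s := {a, b}) (by
            intro n hn
            simp only [Finset.mem_insert, Finset.mem_singleton, not_or] at hn
            simp [hn.1, hn.2])
        rwa [Finset.sum_pair hab, if_pos (.inl rfl), if_pos (.inr rfl), add_halves] at this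
      have h2 : HasSum (fun n => inner ℂ (fock n)
          (InnerProductSpace.rankOne ℂ φ φ (fock n))) 1 := by
        have h := lp.hasSum_norm (p := 2) (by simp) φ
        simp only [ENNReal.toReal_ofNat, Real.rpow_ofNat, hφ, one_pow] at h
        have h' := (Complex.hasSum_ofReal).2 h
        simp only [Complex.ofReal_one] at h'
        convert h' using 2 with n
        rw [InnerProductSpace.rankOne_apply, inner_smul_right, ← inner_conj_symm φ, inner_fock,
          Complex.conj_mul']
        push_cast; rfl
      have := h1.sub h2
      simpa only [sub_apply, inner_sub_right, sub_self] using this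
    refine le_trans ?_ (neg_inner_le_traceNorm hsB htr hφ.le)
    rw [← ENNReal.ofReal_one]
    apply ENNReal.ofReal_le_ofReal
    have h3 : (inner ℂ φ (InnerProductSpace.rankOne ℂ φ φ φ)).re = 1 := by
      rw [InnerProductSpace.rankOne_apply, inner_smul_right, inner_self_eq_norm_sq_to_K, hφ]
      simp
    have h4 : (inner ℂ φ (A φ)).re ≤ 1 / 2 := by
      have hAφ : ∀ n, inner ℂ (fock n) (A φ) = (if n = a ∨ n = b then (1 / 2 : ℂ) else 0) * φ n := by
        intro n
        have : inner ℂ (fock n) (A φ) = inner ℂ (A (fock n)) φ := by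
          nth_rw 1 [← hsa.star_eq]
          rw [ContinuousLinearMap.star_eq_adjoint, ContinuousLinearMap.adjoint_inner_right]
        rw [this, hA, inner_smul_left, inner_fock]
        split_ifs with h
        · simp [h, map_ofNat]
        · simp [h]
      rw [lp.inner_eq_tsum, tsum_eq_sum (s := {a, b}), Finset.sum_pair hab]
      · have e : ∀ n, n = a ∨ n = b → (inner ℂ (φ n) ((A φ) n)).re = 1 / 2 * ‖φ n‖ ^ 2 := by
          intro n hn
          rw [← inner_fock n (A φ), hAφ, if_pos hn, RCLike.inner_apply, mul_assoc, Complex.mul_conj',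
            show (1 / 2 : ℂ) * (‖φ n‖ : ℂ) ^ 2 = ((1 / 2 * ‖φ n‖ ^ 2 : ℝ) : ℂ) by push_cast; rfl,
            Complex.ofReal_re]
        rw [Complex.add_re, e a (.inl rfl), e b (.inr rfl)]
        have := sum_sq_pair_le hab φ
        rw [hφ] at this
        linarith
      · intro n hn
        simp only [Finset.mem_insert, Finset.mem_singleton, not_or] at hn
        rw [← inner_fock n (A φ), hAφ, if_neg (by tauto), zero_mul, inner_zero_right]
    rw [sub_apply, inner_sub_right, Complex.sub_re, h3]
    linarith

/-! ### Measures on sequences of letters from a finite alphabet -/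

section Sequences

variable {R : Type}

/-- The first `t` letters of a sequence. -/
def initial (t : ℕ) (ω : ℕ → R) : Fin t → R := fun i => ω i

/-- The sequences with the same first `t` letters as `ω`. -/
def cyl (t : ℕ) (ω : ℕ → R) : Set (ℕ → R) := {z | ∀ i < t, z i = ω i}

lemma cyl_eq_preimage (t : ℕ) (ω : ℕ → R) : cyl t ω = initial t ⁻¹' {initial t ω} := by
  ext z
  simp only [cyl, initial, Set.mem_ofPred_eq, Set.mem_preimage, Set.mem_singleton_iff, funext_iff]
  exact ⟨fun h i => h i i.2, fun h i hi => h ⟨i, hi⟩⟩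

lemma initial_surjective [Nonempty R] (t : ℕ) :
    Function.Surjective (initial t : (ℕ → R) → Fin t → R) := by
  intro x
  refine ⟨fun i => if h : i < t then x ⟨i, h⟩ else Classical.arbitrary R, ?_⟩
  funext i
  simp [initial]

variable [MeasurableSpace R]

lemma measurable_initial (t : ℕ) : Measurable (initial t : (ℕ → R) → Fin t → R) := by
  unfold initial; fun_prop

/-- The filtration generated by the successive letters. -/
def seqFiltration (R : Type) [MeasurableSpace R] :
    Filtration ℕ (MeasurableSpace.pi : MeasurableSpace (ℕ → R)) where
  seq t := MeasurableSpace.comap (initial t) MeasurableSpace.pi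
  mono' s t hst := by
    change MeasurableSpace.comap (initial s) _ ≤ MeasurableSpace.comap (initial t) _
    have : (initial s : (ℕ → R) → Fin s → R) =
        (fun (x : Fin t → R) (i : Fin s) => x (Fin.castLE hst i)) ∘ initial t := rfl
    rw [this, ← MeasurableSpace.comap_comp]
    apply MeasurableSpace.comap_mono
    apply Measurable.comap_le
    fun_prop
  le' t := (measurable_initial t).comap_le

lemma iSup_seqFiltration : ⨆ t, seqFiltration R t = MeasurableSpace.pi := by
  refine le_antisymm (iSup_le fun t => (seqFiltration R).le t) ?_
  refine iSup_le fun i => le_trans ?_ (le_iSup _ (i + 1))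
  have : (fun ω : ℕ → R => ω i) =
      (fun x : Fin (i + 1) → R => x (Fin.last i)) ∘ initial (i + 1) := rfl
  rw [this, ← MeasurableSpace.comap_comp]
  apply MeasurableSpace.comap_mono
  apply Measurable.comap_le
  fun_prop

lemma measurableSet_cyl [MeasurableSingletonClass R] (t : ℕ) (ω : ℕ → R) : MeasurableSet (cyl t ω) := by
  rw [cyl_eq_preimage]
  exact measurable_initial t (measurableSet_singleton _)

/-- For each `t` there are finitely many words, so those of probability zero form a null set. This
justifies division by cylinder probabilities along almost every sequence. -/
lemma ae_measure_cyl_pos [Finite R] (μ : Measure (ℕ → R)) : ∀ᵐ ω ∂μ, ∀ t, 0 < μ (cyl t ω) := by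
  rw [ae_all_iff]
  intro t
  have : {ω | ¬ 0 < μ (cyl t ω)} =
      ⋃ x ∈ {x : Fin t → R | μ (initial t ⁻¹' {x}) = 0}, initial t ⁻¹' {x} := by
    ext ω
    simp [cyl_eq_preimage]
  rw [ae_iff, this, measure_biUnion_null_iff (Set.to_countable _)]
  exact fun x hx => hx

variable [Finite R] [MeasurableSingletonClass R]

lemma measure_ext_of_cyl [Nonempty R] {μ ν : Measure (ℕ → R)} [IsFiniteMeasure μ]
    (h : ∀ ω t, μ (cyl t ω) = ν (cyl t ω)) : μ = ν := by
  have h1 : ∀ t, μ.map (initial t) = ν.map (initial t) := by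
    intro t
    refine Measure.ext_of_singleton fun x => ?_
    obtain ⟨ω, rfl⟩ := initial_surjective t x
    rw [Measure.map_apply (measurable_initial t) (measurableSet_singleton _),
      Measure.map_apply (measurable_initial t) (measurableSet_singleton _), ← cyl_eq_preimage, h]
  have h2 : ∀ t s, MeasurableSet[seqFiltration R t] s → μ s = ν s := by
    rintro t _ ⟨U, hU, rfl⟩
    rw [← Measure.map_apply (measurable_initial t) hU, h1,
      Measure.map_apply (measurable_initial t) hU]
  refine ext_of_generate_finite (⋃ t, {s | MeasurableSet[seqFiltration R t] s}) ?_
    (isPiSystem_iUnion_of_monotone _ (fun t => @MeasurableSpace.isPiSystem_measurableSet _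
      (seqFiltration R t)) fun s t hst u hu => (seqFiltration R).mono hst u hu) ?_ ?_
  · exact (iSup_seqFiltration (R := R)).symm.trans
      (MeasurableSpace.generateFrom_iUnion_measurableSet _).symm
  · intro s hs
    obtain ⟨t, ht⟩ := Set.mem_iUnion.1 hs
    exact h2 t s ht
  · exact h2 0 _ (@MeasurableSet.univ _ (seqFiltration R 0))

/-- **Lévy's upward theorem** for densities: the quotients of the measures of the cylinder sets
converge to the density. -/
lemma tendsto_measure_cyl_div {μ ν : Measure (ℕ → R)} [IsFiniteMeasure μ] [IsFiniteMeasure ν]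
    (h : ν ≪ μ) : ∀ᵐ ω ∂μ, Tendsto (fun t => ν.real (cyl t ω) / μ.real (cyl t ω)) atTop
      (𝓝 (ν.rnDeriv μ ω).toReal) := by
  have hg : Integrable (fun ω => (ν.rnDeriv μ ω).toReal) μ := Measure.integrable_toReal_rnDeriv
  have hgm : StronglyMeasurable[⨆ t, seqFiltration R t] fun ω => (ν.rnDeriv μ ω).toReal := by
    rw [iSup_seqFiltration]
    exact (Measure.measurable_rnDeriv ν μ).ennreal_toReal.stronglyMeasurable
  -- The σ-algebra of the first `t` letters has the cylinders as atoms, so the quotient is the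
  -- conditional expectation of the density.
  have key : ∀ t, (fun ω => ν.real (cyl t ω) / μ.real (cyl t ω)) =ᵐ[μ]
      μ[fun ω => (ν.rnDeriv μ ω).toReal | seqFiltration R t] := by
    intro t
    let f : (Fin t → R) → ℝ := fun x => ν.real (initial t ⁻¹' {x}) / μ.real (initial t ⁻¹' {x})
    have hf : (fun ω => ν.real (cyl t ω) / μ.real (cyl t ω)) = f ∘ initial t := by
      funext ω; simp only [f, cyl_eq_preimage, Function.comp_apply]
    have hfm : StronglyMeasurable[seqFiltration R t] (f ∘ initial t) :=
      ((measurable_of_finite f).comp (comap_measurable _)).stronglyMeasurable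
    have hfi : Integrable (f ∘ initial t) μ :=
      (integrable_map_measure (measurable_of_finite f).aestronglyMeasurable
        (measurable_initial t).aemeasurable).1 (Integrable.of_finite)
    have := Fintype.ofFinite (Fin t → R)
    rw [hf]
    refine ae_eq_condExp_of_forall_setIntegral_eq ((seqFiltration R).le t) hg
      (fun s _ _ => hfi.integrableOn) ?_ hfm.aestronglyMeasurable
    rintro _ ⟨U, hU, rfl⟩ -
    simp only [Function.comp_apply]
    rw [Measure.setIntegral_toReal_rnDeriv h,
      ← setIntegral_map hU (measurable_of_finite f).aestronglyMeasurable
        (measurable_initial t).aemeasurable, ← map_measureReal_apply (measurable_initial t) hU,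
      ← integral_indicator hU, ← integral_indicator_one hU, integral_fintype Integrable.of_finite,
      integral_fintype Integrable.of_finite]
    refine Finset.sum_congr rfl fun x _ => ?_
    rw [map_measureReal_apply (measurable_initial t) (measurableSet_singleton _),
      map_measureReal_apply (measurable_initial t) (measurableSet_singleton _)]
    by_cases hx : x ∈ U
    · rw [Set.indicator_of_mem hx, Set.indicator_of_mem hx]
      simp only [f, smul_eq_mul, Pi.one_apply, mul_one]
      -- On a `μ`-null atom the quotient is `0` by convention; this is harmless because `ν ≪ μ`
      -- makes the atom `ν`-null too.
      by_cases h0 : μ.real (initial t ⁻¹' {x}) = 0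
      · have h1 := h ((measureReal_eq_zero_iff (measure_ne_top μ _)).1 h0)
        rw [h0, zero_mul, (measureReal_eq_zero_iff (measure_ne_top ν _)).2 h1]
      · field_simp
    · rw [Set.indicator_of_notMem hx, Set.indicator_of_notMem hx]
      simp
  have := hg.tendsto_ae_condExp hgm
  filter_upwards [this, ae_all_iff.2 key] with ω h1 h2
  simpa only [h2] using h1

end Sequences

/-! ### Words and tails -/

/-- The word formed by the first `t` outcomes. -/
def word (t : ℕ) (ω : Omega) : List Outcome := (List.range t).map ω

/-- The sequence without its first `t` outcomes. -/
def tail (t : ℕ) (ω : Omega) : Omega := fun i => ω (t + i)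

lemma measurable_tail (t : ℕ) : Measurable (tail t) := by
  unfold tail; fun_prop

lemma length_word (t : ℕ) (ω : Omega) : (word t ω).length = t := by simp [word]

lemma word_add (t s : ℕ) (ω : Omega) : word (t + s) ω = word t ω ++ word s (tail t ω) := by
  simp [word, tail, List.range_add, Function.comp_def]

lemma tail_add (t s : ℕ) (ω : Omega) : tail (t + s) ω = tail s (tail t ω) := by
  funext i; simp [tail, add_assoc]

lemma mem_cyl_iff {t : ℕ} {ω z : Omega} : z ∈ cyl t ω ↔ word t z = word t ω := by
  simp [cyl, word]

lemma exists_word_eq (u : List Outcome) : ∃ ω, word u.length ω = u := by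
  refine ⟨fun i => u.getD i (false, false), ?_⟩
  apply List.ext_getElem
  · simp [word]
  · intro i h1 h2
    simp [word, h2]

/-- The sequence which starts with the first `t` outcomes of `ω` and goes on with `z`. -/
def splice (t : ℕ) (ω z : Omega) : Omega := fun i => if i < t then ω i else z (i - t)

lemma word_splice (t : ℕ) (ω z : Omega) : word t (splice t ω z) = word t ω := by
  refine List.map_congr_left fun i hi => ?_
  simp [splice, List.mem_range.1 hi]

lemma tail_splice (t : ℕ) (ω z : Omega) : tail t (splice t ω z) = z := by
  funext i; simp [tail, splice]

lemma cyl_inter_preimage_tail (t s : ℕ) (ω z : Omega) :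
    cyl t ω ∩ tail t ⁻¹' cyl s z = cyl (t + s) (splice t ω z) := by
  ext x
  simp only [Set.mem_inter_iff, Set.mem_preimage, mem_cyl_iff, word_add, word_splice, tail_splice]
  constructor
  · rintro ⟨h1, h2⟩; rw [h1, h2]
  · intro h
    exact List.append_inj h (by simp [length_word])

namespace Params

variable (p : Params)

/-! ### The motion on the Fock states -/

/-- The index of the Fock state reached from `|n⟩` under the outcome `y`. -/
def step (n : ℕ) : Outcome → ℕ
  | (false, false) => n
  | (true, true) => n
  -- At `n = 0` the subtraction is truncated, but the amplitude then carries the factor `√0`.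
  | (false, true) => n - 1
  | (true, false) => n + 1

/-- The index of the Fock state reached from `|n⟩` under the word `w`. -/
def pos (n : ℕ) (w : List Outcome) : ℕ := w.foldl step n

/-- The probability of the word `w` for the initial state `|n⟩`. -/
def prob (n : ℕ) (w : List Outcome) : ℝ := ‖p.wordOp w (fock n)‖ ^ 2

lemma pos_append (n : ℕ) (w u : List Outcome) : pos n (w ++ u) = pos (pos n w) u := by
  simp [pos]

lemma exists_V_fock (n : ℕ) (y : Outcome) : ∃ c : ℂ, p.V y (fock n) = c • fock (step n y) := by
  match y with
  | (false, false) => exact ⟨_, p.V_mm_fock n⟩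
  | (true, true) => exact ⟨_, p.V_pp_fock n⟩
  | (false, true) => exact ⟨_, p.V_mp_fock n⟩
  | (true, false) => exact ⟨_, p.V_pm_fock n⟩

lemma exists_wordOp_fock (n : ℕ) (w : List Outcome) :
    ∃ c : ℂ, p.wordOp w (fock n) = c • fock (pos n w) := by
  induction w using List.reverseRecOn with
  | nil => exact ⟨1, by simp [wordOp, pos]⟩
  | append_singleton w y ih =>
    obtain ⟨c, hc⟩ := ih
    obtain ⟨d, hd⟩ := p.exists_V_fock (pos n w) y
    refine ⟨c * d, ?_⟩
    rw [wordOp_append, mul_apply_eq_comp, hc, map_smul, hd, smul_smul, pos_append]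
    rfl

lemma wordOp_append_word (w u : List Outcome) : p.wordOp (w ++ u) = p.wordOp u * p.wordOp w := by
  induction u using List.reverseRecOn with
  | nil => simp [wordOp]
  | append_singleton u y ih =>
    rw [← List.append_assoc, wordOp_append, ih, wordOp_append, mul_assoc]

lemma prob_nonneg (n : ℕ) (w : List Outcome) : 0 ≤ p.prob n w := by unfold prob; positivity

lemma prob_le_one (n : ℕ) (w : List Outcome) : p.prob n w ≤ 1 := p.norm_wordOp_fock_le w n

lemma prob_nil (n : ℕ) : p.prob n [] = 1 := by simp [prob, wordOp, norm_fock]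

lemma prob_append (n : ℕ) (w u : List Outcome) :
    p.prob n (w ++ u) = p.prob n w * p.prob (pos n w) u := by
  obtain ⟨c, hc⟩ := p.exists_wordOp_fock n w
  simp only [prob, wordOp_append_word, mul_apply_eq_comp, hc, map_smul, norm_smul, mul_pow,
    norm_fock, mul_one]

/-- Truncation at the vacuum has amplitude zero, so among possible words the displacement depends on
the word alone. A return to `n` seen from `n` is thus a return to `m` seen from `m`. -/
lemma pos_eq_of_prob_ne_zero {n m : ℕ} {w : List Outcome} (hn : p.prob n w ≠ 0)
    (hm : p.prob m w ≠ 0) : (pos m w : ℤ) - m = pos n w - n := by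
  obtain ⟨s, hs⟩ := p.wordOp_fock w
  have key : ∀ k, p.prob k w ≠ 0 → (pos k w : ℤ) = k + s := by
    intro k hk
    obtain ⟨c, l, h1, h2⟩ := hs k
    obtain ⟨d, h3⟩ := p.exists_wordOp_fock k w
    have hc : c ≠ 0 := by
      rintro rfl
      apply hk
      simp [prob, h1]
    rw [← h2 hc]
    have h4 : inner ℂ (fock l) (c • fock l) = inner ℂ (fock l) (d • fock (pos k w)) := by
      rw [← h1, ← h3]
    rw [inner_smul_right, inner_smul_right, inner_fock_self, inner_fock_fock] at h4
    by_cases h : l = pos k w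
    · rw [h]
    · simp [h, hc] at h4
  rw [key n hn, key m hm]; ring

lemma exists_fockLaw (n : ℕ) : ∃ μ : Measure Omega, IsProbabilityMeasure μ ∧
    ∀ ω t, μ (cyl t ω) = ENNReal.ofReal (p.prob n (word t ω)) :=
  exists_measure_of_consistent (fun w => ENNReal.ofReal (p.prob n w)) (by simp [prob_nil])
    fun w => by
      rw [← ENNReal.ofReal_sum_of_nonneg fun y _ => p.prob_nonneg _ _]
      congr 1
      exact p.sum_norm_wordOp w n

/-- The law of the outcomes for the initial state `|n⟩⟨n|`. -/
def fockLaw (n : ℕ) : Measure Omega := (p.exists_fockLaw n).choose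

instance (n : ℕ) : IsProbabilityMeasure (p.fockLaw n) := (p.exists_fockLaw n).choose_spec.1

lemma fockLaw_cyl (n t : ℕ) (ω : Omega) :
    p.fockLaw n (cyl t ω) = ENNReal.ofReal (p.prob n (word t ω)) :=
  (p.exists_fockLaw n).choose_spec.2 ω t

lemma fockLaw_real_cyl (n t : ℕ) (ω : Omega) :
    (p.fockLaw n).real (cyl t ω) = p.prob n (word t ω) := by
  rw [Measure.real, fockLaw_cyl, ENNReal.toReal_ofReal (p.prob_nonneg _ _)]

/-- The **Markov property** of the outcomes. -/
lemma fockLaw_cyl_inter (n t : ℕ) (ω : Omega) {B : Set Omega} (hB : MeasurableSet B) :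
    p.fockLaw n (cyl t ω ∩ tail t ⁻¹' B) =
      ENNReal.ofReal (p.prob n (word t ω)) * p.fockLaw (pos n (word t ω)) B := by
  have h : ((p.fockLaw n).restrict (cyl t ω)).map (tail t) =
      ENNReal.ofReal (p.prob n (word t ω)) • p.fockLaw (pos n (word t ω)) := by
    apply measure_ext_of_cyl
    intro z s
    rw [Measure.map_apply (measurable_tail t) (measurableSet_cyl s z),
      Measure.restrict_apply (measurable_tail t (measurableSet_cyl s z)), Set.inter_comm,
      cyl_inter_preimage_tail, fockLaw_cyl, word_add, word_splice, tail_splice, prob_append,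
      ENNReal.ofReal_mul (p.prob_nonneg _ _), Measure.smul_apply, fockLaw_cyl, smul_eq_mul]
  have h2 := congrArg (fun μ => μ B) h
  beta_reduce at h2
  rwa [Measure.map_apply (measurable_tail t) hB,
    Measure.restrict_apply (measurable_tail t hB), Set.inter_comm] at h2

/-! ### The Gibbs weights and the stationary process -/

/-- The weight of the Fock state `|n⟩` in the invariant state. -/
def weight (n : ℕ) : ℝ := (1 - Real.exp (-p.beta * p.eps)) * Real.exp (-p.beta * p.eps) ^ n

lemma exp_lt_one : Real.exp (-p.beta * p.eps) < 1 := by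
  rw [Real.exp_lt_one_iff]
  have := mul_pos p.beta_pos p.eps_pos
  linarith

lemma weight_pos (n : ℕ) : 0 < p.weight n :=
  mul_pos (sub_pos.2 p.exp_lt_one) (pow_pos (Real.exp_pos _) n)

lemma hasSum_weight : HasSum p.weight 1 := by
  have := (hasSum_geometric_of_lt_one (Real.exp_pos _).le p.exp_lt_one).mul_left
    (1 - Real.exp (-p.beta * p.eps))
  rwa [mul_inv_cancel₀ (sub_pos.2 p.exp_lt_one).ne'] at this

/-- Detailed balance: both the Gibbs weights and the atomic populations have ratio `e^{-βε}`. -/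
lemma weight_succ_mul (n : ℕ) :
    p.weight (n + 1) * p.pAt false = p.weight n * p.pAt true := by
  simp only [weight, pAt, pow_succ]; ring

/-- The joint law of the initial Fock state, with the Gibbs distribution, and the outcomes. -/
def joint : Measure (ℕ × Omega) :=
  Measure.sum fun n => ENNReal.ofReal (p.weight n) • (p.fockLaw n).map (Prod.mk n)

lemma joint_apply {s : Set (ℕ × Omega)} (hs : MeasurableSet s) :
    p.joint s = ∑' n, ENNReal.ofReal (p.weight n) * p.fockLaw n (Prod.mk n ⁻¹' s) := by
  rw [joint, Measure.sum_apply _ hs]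
  congr 1; funext n
  rw [Measure.smul_apply, Measure.map_apply measurable_prodMk_left hs, smul_eq_mul]

lemma tsum_ofReal_weight : ∑' n, ENNReal.ofReal (p.weight n) = 1 := by
  rw [← ENNReal.ofReal_tsum_of_nonneg (fun n => (p.weight_pos n).le) p.hasSum_weight.summable,
    p.hasSum_weight.tsum_eq, ENNReal.ofReal_one]

instance : IsProbabilityMeasure p.joint := ⟨by
  rw [p.joint_apply .univ]; simp [tsum_ofReal_weight]⟩

/-- Every level has positive Gibbs weight, so a stationary almost sure statement holds from each
deterministic starting level. -/
lemma ae_fockLaw_of_ae_joint {P : ℕ × Omega → Prop} (h : ∀ᵐ x ∂p.joint, P x) (n : ℕ) :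
    ∀ᵐ ω ∂p.fockLaw n, P (n, ω) := by
  have h1 := Measure.ae_sum_iff.1 h n
  rw [Measure.ae_ennreal_smul_measure_iff (by simpa using p.weight_pos n)] at h1
  exact ae_of_ae_map measurable_prodMk_left.aemeasurable h1

/-- One step of the motion, on the pairs of a Fock state and the sequence of outcomes to come. -/
def shift (x : ℕ × Omega) : ℕ × Omega := (step x.1 (x.2 0), tail 1 x.2)

lemma measurable_shift : Measurable shift :=
  ((measurable_of_countable (fun a : ℕ × Outcome => step a.1 a.2)).comp
    (measurable_fst.prodMk ((measurable_pi_apply 0).comp measurable_snd))).prodMk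
    ((measurable_tail 1).comp measurable_snd)

lemma shift_iterate (t n : ℕ) (ω : Omega) : shift^[t] (n, ω) = (pos n (word t ω), tail t ω) := by
  induction t with
  | zero => simp [pos, word, funext_iff, tail]
  | succ t ih =>
    rw [Function.iterate_succ_apply', ih, shift, word_add, pos_append, tail_add]
    rfl

lemma prob_singleton_tsum (n : ℕ) (F : ℕ → ℝ≥0∞) :
    ∑ y, ENNReal.ofReal (p.prob n [y]) * F (step n y) =
      ENNReal.ofReal (p.pAt false * ‖p.C n‖ ^ 2) * F n +
      ENNReal.ofReal (p.pAt true * ‖p.C (n + 1)‖ ^ 2) * F n +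
      ENNReal.ofReal (p.pAt false * (n * p.S n ^ 2)) * F (n - 1) +
      ENNReal.ofReal (p.pAt true * ((n + 1 : ℕ) * p.S (n + 1) ^ 2)) * F (n + 1) := by
  have hf := p.pAt_nonneg false
  have ht := p.pAt_nonneg true
  have hn : (0 : ℝ) ≤ n := n.cast_nonneg
  have hn1 : (0 : ℝ) ≤ (n : ℝ) + 1 := by positivity
  rw [Fintype.sum_prod_type]
  have e : ∀ y, p.prob n [y] = ‖p.V y (fock n)‖ ^ 2 := by intro y; simp [prob, wordOp]
  simp only [Fintype.sum_bool, e, V_mm_fock, V_pp_fock, V_mp_fock, V_pm_fock, norm_smul, norm_mul,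
    norm_phase, norm_fock, Complex.norm_real, Real.norm_eq_abs, norm_star, mul_one, one_mul, mul_pow,
    sq_abs, Real.sq_sqrt hf, Real.sq_sqrt ht, Real.sq_sqrt hn, Real.sq_sqrt hn1, step]
  push_cast
  rw [mul_comm ((n : ℝ) + 1), mul_comm (n : ℝ)]
  ring

/-- By the Markov property, only invariance of the Gibbs weights for the level chain is at stake,
and this follows from detailed balance between neighbouring levels. -/
lemma measurePreserving_shift : MeasurePreserving shift p.joint p.joint := by
  refine ⟨measurable_shift, Measure.ext fun s hs => ?_⟩
  rw [Measure.map_apply measurable_shift hs, p.joint_apply (measurable_shift hs), p.joint_apply hs]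
  set F : ℕ → ℝ≥0∞ := fun k => p.fockLaw k (Prod.mk k ⁻¹' s) with hF
  have h1 : ∀ n, p.fockLaw n (Prod.mk n ⁻¹' (shift ⁻¹' s)) =
      ∑ y, ENNReal.ofReal (p.prob n [y]) * F (step n y) := by
    intro n
    have hu : Prod.mk n ⁻¹' (shift ⁻¹' s) = ⋃ y : Outcome,
        (cyl 1 (fun _ => y) ∩ tail 1 ⁻¹' (Prod.mk (step n y) ⁻¹' s)) := by
      ext ω
      simp [shift, cyl]
    have hm : ∀ y : Outcome, MeasurableSet (Prod.mk (step n y) ⁻¹' s : Set Omega) :=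
      fun y => measurable_prodMk_left hs
    rw [hu, measure_iUnion, tsum_fintype]
    · refine Finset.sum_congr rfl fun y _ => ?_
      rw [p.fockLaw_cyl_inter n 1 _ (hm y)]
      rfl
    · intro y z hyz
      refine Set.disjoint_left.2 fun ω hy hz => hyz ?_
      have h1 := hy.1 0 one_pos
      have h2 := hz.1 0 one_pos
      exact h1.symm.trans h2
    · exact fun y => (measurableSet_cyl _ _).inter (measurable_tail 1 (hm y))
  have hf := p.pAt_nonneg false
  have ht := p.pAt_nonneg true
  have hw := fun n => (p.weight_pos n).le
  have hb : ∀ n : ℕ, 0 ≤ n * p.S n ^ 2 := fun n => by positivity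
  simp only [h1, prob_singleton_tsum, mul_add, ENNReal.tsum_add]
  have hsw : ∀ (n : ℕ) (b : ℝ), ENNReal.ofReal (p.weight (n + 1)) *
      ENNReal.ofReal (p.pAt false * b) =
      ENNReal.ofReal (p.weight n) * ENNReal.ofReal (p.pAt true * b) := by
    intro n b
    rw [← ENNReal.ofReal_mul (hw _), ← ENNReal.ofReal_mul (hw _), ← mul_assoc, ← mul_assoc,
      weight_succ_mul]
  -- Downward jumps into `n` balance upward jumps out of `n`; the term `n = 0` drops out through its
  -- factor `n`. The next identity is the reverse exchange.
  have e3 : ∑' n, ENNReal.ofReal (p.weight n) *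
      (ENNReal.ofReal (p.pAt false * (n * p.S n ^ 2)) * F (n - 1)) =
      ∑' n, ENNReal.ofReal (p.weight n) *
        (ENNReal.ofReal (p.pAt true * ((n + 1 : ℕ) * p.S (n + 1) ^ 2)) * F n) := by
    rw [tsum_eq_zero_add' ENNReal.summable]
    simp only [Nat.cast_zero, zero_mul, mul_zero, ENNReal.ofReal_zero, zero_add,
      Nat.add_sub_cancel]
    congr 1; funext n
    rw [← mul_assoc (ENNReal.ofReal _), ← mul_assoc (ENNReal.ofReal _), hsw]
  have e4 : ∑' n, ENNReal.ofReal (p.weight n) *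
      (ENNReal.ofReal (p.pAt true * ((n + 1 : ℕ) * p.S (n + 1) ^ 2)) * F (n + 1)) =
      ∑' n, ENNReal.ofReal (p.weight n) *
        (ENNReal.ofReal (p.pAt false * (n * p.S n ^ 2)) * F n) := by
    conv_rhs => rw [tsum_eq_zero_add' ENNReal.summable]
    simp only [Nat.cast_zero, zero_mul, mul_zero, ENNReal.ofReal_zero, zero_add]
    congr 1; funext n
    rw [← mul_assoc (ENNReal.ofReal _), ← mul_assoc (ENNReal.ofReal _), hsw]
  rw [e3, e4, ← ENNReal.tsum_add, ← ENNReal.tsum_add, ← ENNReal.tsum_add]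
  congr 1; funext n
  simp only [← mul_add, ← add_mul]
  rw [← ENNReal.ofReal_add (by positivity) (by positivity),
    ← ENNReal.ofReal_add (by positivity) (mul_nonneg ht (hb _)),
    ← ENNReal.ofReal_add (by have := hb (n + 1); positivity) (mul_nonneg hf (hb _))]
  have e5 := p.normSq_C_add n
  have e6 := p.normSq_C_add (n + 1)
  have e7 := p.pAt_add
  have e8 : p.pAt false * ‖p.C n‖ ^ 2 + p.pAt true * ‖p.C (n + 1)‖ ^ 2 +
      p.pAt true * ((n + 1 : ℕ) * p.S (n + 1) ^ 2) + p.pAt false * (n * p.S n ^ 2) = 1 := by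
    linear_combination p.pAt false * e5 + p.pAt true * e6 + e7
  rw [e8, ENNReal.ofReal_one, one_mul]

/-- **Recurrence**: the motion returns to its initial Fock state. -/
lemma ae_frequently_return (n : ℕ) {A : Set Omega} (hA : MeasurableSet A) :
    ∀ᵐ ω ∂p.fockLaw n, ω ∈ A →
      ∃ᶠ t in atTop, pos n (word t ω) = n ∧ tail t ω ∈ A := by
  have h := p.measurePreserving_shift.conservative.ae_mem_imp_frequently_image_mem
    ((measurableSet_singleton n).prod hA).nullMeasurableSet
  filter_upwards [p.ae_fockLaw_of_ae_joint h n] with ω hω hωA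
  have := hω ⟨rfl, hωA⟩
  refine this.mono fun t ht => ?_
  rw [shift_iterate] at ht
  exact ht

/-! ### Mutual singularity -/

/-- The law of the outcomes for the invariant initial state. -/
def mix : Measure Omega := p.joint.map Prod.snd

instance : IsProbabilityMeasure p.mix := Measure.isProbabilityMeasure_map measurable_snd.aemeasurable

lemma mix_eq_sum : p.mix = Measure.sum fun n => ENNReal.ofReal (p.weight n) • p.fockLaw n := by
  refine Measure.ext fun s hs => ?_
  rw [mix, Measure.map_apply measurable_snd hs, p.joint_apply (measurable_snd hs),
    Measure.sum_apply _ hs]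
  rfl

lemma fockLaw_absolutelyContinuous (n : ℕ) : p.fockLaw n ≪ p.mix := by
  rw [mix_eq_sum]
  refine Measure.absolutelyContinuous_sum_right n ?_
  exact Measure.absolutelyContinuous_smul (by simpa using p.weight_pos n)

/-- The density of the law of the outcomes for the initial state `|n⟩⟨n|` with respect to the law
for the invariant state. -/
def density (n : ℕ) (ω : Omega) : ℝ := ((p.fockLaw n).rnDeriv p.mix ω).toReal

lemma measurable_density (n : ℕ) : Measurable (p.density n) :=
  (Measure.measurable_rnDeriv _ _).ennreal_toReal

lemma density_nonneg (n : ℕ) (ω : Omega) : 0 ≤ p.density n ω := ENNReal.toReal_nonneg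

lemma tendsto_density (n : ℕ) : ∀ᵐ ω ∂p.mix, Tendsto
    (fun t => p.prob n (word t ω) / p.mix.real (cyl t ω)) atTop (𝓝 (p.density n ω)) := by
  filter_upwards [tendsto_measure_cyl_div (p.fockLaw_absolutelyContinuous n)] with ω h
  simp only [fockLaw_real_cyl] at h
  exact h

lemma ae_density_pos (n : ℕ) : ∀ᵐ ω ∂p.fockLaw n, 0 < p.density n ω := by
  filter_upwards [Measure.rnDeriv_pos (p.fockLaw_absolutelyContinuous n),
    (p.fockLaw_absolutelyContinuous n).ae_le (Measure.rnDeriv_lt_top (p.fockLaw n) p.mix)]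
    with ω h1 h2
  exact ENNReal.toReal_pos h1.ne' h2.ne

/-- Where the density of the law for `|m⟩` does not vanish, the words seen from `|n⟩` have the same
probability for `|m⟩` and for `|n⟩`. -/
lemma ae_prob_eq_of_density_ne_zero (n m : ℕ) :
    ∀ᵐ ω ∂p.fockLaw n, p.density m ω ≠ 0 → ∀ L, p.prob m (word L ω) = p.prob n (word L ω) := by
  have hA : ∀ u : List Outcome,
      MeasurableSet {ω | p.density m ω ≠ 0 ∧ word u.length ω = u} := by
    intro u
    obtain ⟨z, hz⟩ := exists_word_eq u
    have e : {ω | p.density m ω ≠ 0 ∧ word u.length ω = u} =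
        {ω | p.density m ω ≠ 0} ∩ cyl u.length z := by
      ext ω; simp only [Set.mem_inter_iff, mem_cyl_iff, hz]; rfl
    rw [e]
    refine MeasurableSet.inter ?_ (measurableSet_cyl _ _)
    exact p.measurable_density m (measurableSet_singleton 0).compl
  -- There are countably many words, so recurrence holds simultaneously for all of them and may be
  -- applied to the prefix of `ω` itself.
  have h1 := ae_all_iff.2 fun u => p.ae_frequently_return n (hA u)
  filter_upwards [h1, p.ae_density_pos n, (p.fockLaw_absolutelyContinuous n).ae_le
    (p.tendsto_density n), (p.fockLaw_absolutelyContinuous n).ae_le (p.tendsto_density m)]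
    with ω hret hn htn htm hm L
  have hm0 : 0 < p.density m ω := (p.density_nonneg m ω).lt_of_ne' hm
  have hfr := hret (word L ω) ⟨hm, by rw [length_word]⟩
  set u := word L ω with hu
  set r : ℕ → ℝ := fun t => p.prob m (word t ω) / p.mix.real (cyl t ω) with hr
  set s : ℕ → ℝ := fun t => p.prob n (word t ω) / p.mix.real (cyl t ω) with hs
  have hrpos : ∀ᶠ t in atTop, 0 < r t := htm.eventually (lt_mem_nhds hm0)
  have hspos : ∀ᶠ t in atTop, 0 < s t := htn.eventually (lt_mem_nhds hn)
  -- Cross-multiplied form of the likelihood ratio update when `u` recurs from level `n`. In the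
  -- limit the densities cancel and leave equality of the two probabilities of `u`.
  have h2 : ∃ᶠ t in atTop, r (t + L) * s t * p.prob n u = r t * s (t + L) * p.prob m u := by
    refine (hfr.and_eventually (hrpos.and hspos)).mono ?_
    rintro t ⟨⟨hp, -, hw⟩, hrt, hst⟩
    have hqm : p.prob m (word t ω) ≠ 0 := by
      intro h; simp [hr, h] at hrt
    have hqn : p.prob n (word t ω) ≠ 0 := by
      intro h; simp [hs, h] at hst
    have hpm : pos m (word t ω) = m := by
      have := p.pos_eq_of_prob_ne_zero hqn hqm
      rw [hp] at this
      omega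
    have hwL : word (t + L) ω = word t ω ++ u := by
      rw [word_add]
      rw [hu, length_word, ← hu] at hw
      rw [hw]
    simp only [hr, hs, hwL, prob_append, hp, hpm]
    ring
  have h3 := tendsto_nhds_unique_of_frequently_eq
    ((((tendsto_add_atTop_iff_nat L).2 htm).mul htn).mul_const (p.prob n u))
    ((htm.mul ((tendsto_add_atTop_iff_nat L).2 htn)).mul_const (p.prob m u)) h2
  exact (mul_left_cancel₀ (mul_pos hm0 hn).ne' h3).symm

lemma measurableSet_prob_eq (n m : ℕ) :
    MeasurableSet {ω : Omega | ∀ t, p.prob m (word t ω) = p.prob n (word t ω)} := by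
  rw [Set.ofPred_forall]
  refine MeasurableSet.iInter fun t => ?_
  have : {ω : Omega | p.prob m (word t ω) = p.prob n (word t ω)} =
      initial t ⁻¹' {x | p.prob m (List.ofFn x) = p.prob n (List.ofFn x)} := by
    ext ω
    have : List.ofFn (initial t ω) = word t ω := by
      apply List.ext_getElem <;> simp [word, initial]
    simp only [Set.mem_ofPred_eq, Set.mem_preimage, this]
  rw [this]
  exact measurable_initial t (Set.toFinite _).measurableSet

/-- Along a typical point of the event `B`, the conditional probability of `B` given the prefix
tends to `1`. At return times `B` forces its own tail to lie in `B`, so this conditional probability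
is at most `P_n(B)`; hence `P_n(B) = 1`. -/
lemma ae_prob_eq_of_measure_ne_zero {n m : ℕ}
    (h : p.fockLaw n {ω | ∀ t, p.prob m (word t ω) = p.prob n (word t ω)} ≠ 0) :
    ∀ᵐ ω ∂p.fockLaw n, ∀ t, p.prob m (word t ω) = p.prob n (word t ω) := by
  set B : Set Omega := {ω | ∀ t, p.prob m (word t ω) = p.prob n (word t ω)} with hB
  have hBm : MeasurableSet B := p.measurableSet_prob_eq n m
  have hd := tendsto_measure_cyl_div (μ := p.fockLaw n) (ν := (p.fockLaw n).restrict B)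
    Measure.restrict_le_self.absolutelyContinuous
  have hfreq : ∃ᵐ ω ∂p.fockLaw n, ω ∈ B := by
    rwa [frequently_ae_mem_iff]
  obtain ⟨ω, hωB, hlim, hone, hret, hpos⟩ := (hfreq.and_eventually (hd.and
    ((Measure.rnDeriv_restrict_self (p.fockLaw n) hBm).and
      ((p.ae_frequently_return n hBm).and (ae_measure_cyl_pos (p.fockLaw n)))))).exists
  rw [hone, Set.indicator_of_mem hωB, Pi.one_apply, ENNReal.toReal_one] at hlim
  have hle : 1 ≤ (p.fockLaw n).real B := by
    refine le_of_tendsto_of_frequently hlim ((hret hωB).mono ?_)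
    rintro t ⟨hp, -⟩
    have hq : p.prob n (word t ω) ≠ 0 := by
      have := hpos t
      rw [fockLaw_cyl] at this
      exact (ENNReal.ofReal_pos.1 this).ne'
    have hqm : p.prob m (word t ω) ≠ 0 := by rwa [hωB t]
    have hpm : pos m (word t ω) = m := by
      have := p.pos_eq_of_prob_ne_zero hq hqm
      rw [hp] at this
      omega
    have hsub : cyl t ω ∩ B ⊆ cyl t ω ∩ tail t ⁻¹' B := by
      rintro z ⟨hz, hzB⟩
      refine ⟨hz, fun s => ?_⟩
      have h1 := hzB (t + s)
      rw [word_add, mem_cyl_iff.1 hz, prob_append, prob_append, hp, hpm, hωB t] at h1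
      exact mul_left_cancel₀ hq h1
    rw [div_le_iff₀ (by rw [fockLaw_real_cyl]; exact (p.prob_nonneg _ _).lt_of_ne' hq),
      measureReal_restrict_apply (measurableSet_cyl t ω)]
    refine (measureReal_mono hsub).trans_eq ?_
    rw [Measure.real, p.fockLaw_cyl_inter n t ω hBm, ENNReal.toReal_mul, hp, ← fockLaw_cyl,
      mul_comm]
    rfl
  have : p.fockLaw n B = 1 := by
    refine le_antisymm MeasureTheory.prob_le_one ?_
    rw [← ENNReal.ofReal_one]
    exact ENNReal.ofReal_le_of_le_toReal hle
  exact (prob_compl_eq_zero_iff hBm).2 this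

/-- A word of positive `P_n`-probability meets the almost sure event, so `prob n ≤ prob m` on all
words. The one-letter extensions of a word have equal totals by induction, so none of these
inequalities is strict. -/
lemma prob_eq_of_ae {n m : ℕ}
    (h : ∀ᵐ ω ∂p.fockLaw n, ∀ t, p.prob m (word t ω) = p.prob n (word t ω)) (u : List Outcome) :
    p.prob m u = p.prob n u := by
  have key : ∀ u, p.prob n u ≤ p.prob m u := by
    intro u
    by_cases h0 : p.prob n u = 0
    · rw [h0]; exact p.prob_nonneg m u
    obtain ⟨z, hz⟩ := exists_word_eq u
    have hf : ∃ᵐ ω ∂p.fockLaw n, ω ∈ cyl u.length z := by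
      rw [frequently_ae_mem_iff, fockLaw_cyl, hz]
      simpa using (p.prob_nonneg n u).lt_of_ne' h0
    obtain ⟨ω, h1, h2⟩ := (hf.and_eventually h).exists
    have h3 := h2 u.length
    rw [mem_cyl_iff.1 h1, hz] at h3
    exact h3.ge
  induction u using List.reverseRecOn with
  | nil => rw [prob_nil, prob_nil]
  | append_singleton u y ih =>
    have e : ∑ y, p.prob n (u ++ [y]) = ∑ y, p.prob m (u ++ [y]) :=
      (p.sum_norm_wordOp u n).trans (ih.symm.trans (p.sum_norm_wordOp u m).symm)
    exact ((Finset.sum_eq_sum_iff_of_le fun y _ => key _).1 e y (Finset.mem_univ y)).symm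

/-- Two distinct laws of the outcomes for Fock states are mutually singular. -/
lemma ae_density_eq_zero {n m : ℕ} (h : ∃ u, p.prob m u ≠ p.prob n u) :
    ∀ᵐ ω ∂p.fockLaw n, p.density m ω = 0 := by
  by_contra hc
  obtain ⟨u, hu⟩ := h
  refine hu (p.prob_eq_of_ae (p.ae_prob_eq_of_measure_ne_zero ?_) u)
  intro h0
  apply hc
  have h1 : ∀ᵐ ω ∂p.fockLaw n, ¬ ∀ t, p.prob m (word t ω) = p.prob n (word t ω) := by
    rw [ae_iff]; simpa only [not_not] using h0
  filter_upwards [h1, p.ae_prob_eq_of_density_ne_zero n m] with ω h2 h3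
  by_contra h4
  exact h2 (h3 h4)

end Params

/-- **Scheffé's lemma** for probability vectors. -/
lemma tendsto_tsum_abs_sub {f : ℕ → ℕ → ℝ} {g : ℕ → ℝ} (hf0 : ∀ t n, 0 ≤ f t n)
    (hg0 : ∀ n, 0 ≤ g n) (hf : ∀ t, HasSum (f t) 1) (hg : HasSum g 1)
    (h : ∀ n, Tendsto (fun t => f t n) atTop (𝓝 (g n))) :
    Tendsto (fun t => ∑' n, |f t n - g n|) atTop (𝓝 0) := by
  have hmin : Tendsto (fun t => ∑' n, min (f t n) (g n)) atTop (𝓝 (∑' n, g n)) := by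
    refine tendsto_tsum_of_dominated_convergence hg.summable (fun n => ?_) (.of_forall fun t n => ?_)
    · simpa using (h n).min (tendsto_const_nhds (x := g n))
    · rw [Real.norm_eq_abs, abs_of_nonneg (le_min (hf0 t n) (hg0 n))]
      exact min_le_right _ _
  have hms : ∀ t, Summable fun n => min (f t n) (g n) := fun t =>
    hg.summable.of_nonneg_of_le (fun n => le_min (hf0 t n) (hg0 n)) fun n => min_le_right _ _
  -- The identity `|x - y| = x + y - 2 min x y` reduces the claim to the minima, which are dominated
  -- by `g`.
  have e : ∀ t, ∑' n, |f t n - g n| = 2 - 2 * ∑' n, min (f t n) (g n) := by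
    intro t
    have h1 : ∀ n, |f t n - g n| = f t n + g n - 2 * min (f t n) (g n) := by
      intro n
      rcases le_total (f t n) (g n) with h | h
      · rw [min_eq_left h, abs_of_nonpos (sub_nonpos.2 h)]; ring
      · rw [min_eq_right h, abs_of_nonneg (sub_nonneg.2 h)]; ring
    simp only [h1]
    rw [(((hf t).add hg).sub ((hms t).hasSum.mul_left 2)).tsum_eq]
    ring
  simp only [e]
  have := (hmin.const_mul 2).const_sub 2
  rw [hg.tsum_eq] at this
  simpa using this

namespace Params

variable (p : Params)

/-! ### The operators `M_t` and their limits -/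

lemma isDiag_gibbs : IsDiag p.gibbs fun n => ((Real.exp (-p.beta * p.eps) ^ n : ℝ) : ℂ) := by
  intro n
  apply lp.ext; funext m
  rw [lp.coeFn_smul, Pi.smul_apply, gibbs, contraction_apply]
  change (Real.exp (-p.beta * p.eps * m) : ℂ) * fock n m = _ * fock n m
  by_cases hm : m = n
  · subst hm
    congr 2
    rw [← Real.exp_nat_mul, mul_comm (m : ℝ)]
  · simp [fock, hm]

lemma isDiag_rhoInv : IsDiag p.rhoInv fun n => (p.weight n : ℂ) := by
  have h : tr p.gibbs = (((1 - Real.exp (-p.beta * p.eps))⁻¹ : ℝ) : ℂ) := by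
    rw [p.isDiag_gibbs.tr_eq, ← Complex.ofReal_tsum,
      tsum_geometric_of_lt_one (Real.exp_pos _).le p.exp_lt_one]
  have hs := p.isDiag_gibbs.smul (tr p.gibbs)⁻¹
  have e : ∀ n, (tr p.gibbs)⁻¹ * ((Real.exp (-p.beta * p.eps) ^ n : ℝ) : ℂ) = p.weight n := by
    intro n
    rw [h, ← Complex.ofReal_inv, inv_inv, ← Complex.ofReal_mul]
    rfl
  simp only [e] at hs
  exact hs

lemma isDiag_star_wordOp_mul (w : List Outcome) :
    IsDiag (star (p.wordOp w) * p.wordOp w) fun n => (p.prob n w : ℂ) :=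
  fun n => p.star_wordOp_mul_fock w n

lemma hasSum_mix (t : ℕ) (ω : Omega) :
    HasSum (fun n => p.weight n * p.prob n (word t ω)) (p.mix.real (cyl t ω)) := by
  have h0 : ∀ n, 0 ≤ p.weight n * p.prob n (word t ω) := fun n =>
    mul_nonneg (p.weight_pos n).le (p.prob_nonneg _ _)
  have hs : Summable fun n => p.weight n * p.prob n (word t ω) :=
    p.hasSum_weight.summable.of_nonneg_of_le h0 fun n =>
      mul_le_of_le_one_right (p.weight_pos n).le (p.prob_le_one _ _)
  convert hs.hasSum
  rw [Measure.real, mix_eq_sum, Measure.sum_apply _ (measurableSet_cyl t ω)]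
  simp only [Measure.smul_apply, fockLaw_cyl, smul_eq_mul,
    ← ENNReal.ofReal_mul (p.weight_pos _).le]
  rw [← ENNReal.ofReal_tsum_of_nonneg h0 hs, ENNReal.toReal_ofReal (tsum_nonneg h0)]

/-- The probability of the initial state `|n⟩` given the first outcomes, for the invariant state. -/
def posterior (t : ℕ) (ω : Omega) (n : ℕ) : ℝ :=
  p.weight n * (p.prob n (word t ω) / p.mix.real (cyl t ω))

lemma posterior_nonneg (t : ℕ) (ω : Omega) (n : ℕ) : 0 ≤ p.posterior t ω n :=
  mul_nonneg (p.weight_pos n).le (div_nonneg (p.prob_nonneg _ _) measureReal_nonneg)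

lemma hasSum_posterior {t : ℕ} {ω : Omega} (h : p.mix.real (cyl t ω) ≠ 0) :
    HasSum (p.posterior t ω) 1 := by
  have := (p.hasSum_mix t ω).div_const (p.mix.real (cyl t ω))
  rw [div_self h] at this
  simp only [mul_div_assoc] at this
  exact this

/-- All factors are diagonal, and the normalising trace is the Gibbs mixture's probability of the
prefix: this is Bayes' formula. If that probability vanishes, both sides are `0`. -/
lemma isDiag_M (t : ℕ) (ω : Omega) : IsDiag (p.M t ω) fun n => (p.posterior t ω n : ℂ) := by
  have hW : p.W t ω = p.wordOp (word t ω) := rfl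
  have h1 := p.isDiag_star_wordOp_mul (word t ω)
  have h2 := p.isDiag_rhoInv.opSqrt fun n => (p.weight_pos n).le
  have h3 : tr (star (p.W t ω) * p.W t ω * p.rhoInv) = (p.mix.real (cyl t ω) : ℂ) := by
    rw [hW, (h1.mul p.isDiag_rhoInv).tr_eq, ← (p.hasSum_mix t ω).tsum_eq, Complex.ofReal_tsum]
    congr 1; funext n
    push_cast; ring
  unfold M
  rw [h3]
  have h4 := ((h2.mul h1).mul h2).smul (p.mix.real (cyl t ω) : ℂ)⁻¹
  have e : ∀ n, (p.mix.real (cyl t ω) : ℂ)⁻¹ *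
      ((√(p.weight n) : ℂ) * (p.prob n (word t ω) : ℂ) * (√(p.weight n) : ℂ)) =
      (p.posterior t ω n : ℂ) := by
    intro n
    rw [posterior, ← Complex.ofReal_inv]
    norm_cast
    rw [mul_right_comm, Real.mul_self_sqrt (p.weight_pos n).le]
    ring
  simp only [e] at h4
  exact h4

/-- The Fock states with the same law of the outcomes as `|n⟩`. -/
def classOf (n : ℕ) : Set ℕ := {k | ∀ w, p.prob k w = p.prob n w}

lemma mem_classOf_self (n : ℕ) : n ∈ p.classOf n := fun _ => rfl

/-- The invariant state conditioned on the Fock states with index in `𝒩`. -/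
def condState (𝒩 : Set ℕ) : Op :=
  (tr (p.rhoInv * fockProj 𝒩))⁻¹ • (fockProj 𝒩 * p.rhoInv * fockProj 𝒩)

lemma isDiag_condState (𝒩 : Set ℕ) : IsDiag (p.condState 𝒩) fun n =>
    ((𝒩.indicator p.weight n / ∑' k, 𝒩.indicator p.weight k : ℝ) : ℂ) := by
  have h : tr (p.rhoInv * fockProj 𝒩) = ((∑' k, 𝒩.indicator p.weight k : ℝ) : ℂ) := by
    rw [(p.isDiag_rhoInv.mul (isDiag_fockProj 𝒩)).tr_eq, Complex.ofReal_tsum]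
    congr 1; funext n
    by_cases hn : n ∈ 𝒩 <;> simp [hn]
  unfold condState
  rw [h]
  convert (((isDiag_fockProj 𝒩).mul p.isDiag_rhoInv).mul (isDiag_fockProj 𝒩)).smul
    ((∑' k, 𝒩.indicator p.weight k : ℝ) : ℂ)⁻¹ using 2 with n
  by_cases hn : n ∈ 𝒩 <;> simp [hn, div_eq_inv_mul]

lemma tsum_indicator_weight_pos {𝒩 : Set ℕ} {n : ℕ} (hn : n ∈ 𝒩) :
    0 < ∑' k, 𝒩.indicator p.weight k := by
  refine (p.hasSum_weight.summable.indicator 𝒩).tsum_pos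
    (fun k => Set.indicator_nonneg (fun k _ => (p.weight_pos k).le) k) n ?_
  rw [Set.indicator_of_mem hn]
  exact p.weight_pos n

lemma condState_classOf_ne {𝒩 : Set ℕ} {n : ℕ} (hn : n ∉ 𝒩) :
    p.condState (p.classOf n) ≠ p.condState 𝒩 := by
  intro h
  have h1 := (p.isDiag_condState (p.classOf n)).inner_fock_apply n
  rw [h, (p.isDiag_condState 𝒩).inner_fock_apply n, Set.indicator_of_notMem hn,
    Set.indicator_of_mem (p.mem_classOf_self n)] at h1
  have h2 := div_pos (p.weight_pos n) (p.tsum_indicator_weight_pos (p.mem_classOf_self n))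
  rw [zero_div, Complex.ofReal_inj] at h1
  exact h2.ne h1

/-- The weighted densities add up to the density of the Gibbs mixture with respect to itself. Thus
no posterior mass escapes to infinity, as Scheffé's lemma requires. -/
lemma ae_hasSum_density : ∀ᵐ ω ∂p.mix, HasSum (fun n => p.weight n * p.density n ω) 1 := by
  have hm : ∀ n, Measurable fun ω =>
      ENNReal.ofReal (p.weight n) * (p.fockLaw n).rnDeriv p.mix ω := fun n =>
    (Measure.measurable_rnDeriv _ _).const_mul _
  have h1 : p.mix = p.mix.withDensity
      (fun ω => ∑' n, ENNReal.ofReal (p.weight n) * (p.fockLaw n).rnDeriv p.mix ω) := by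
    have e : (fun ω => ∑' n, ENNReal.ofReal (p.weight n) * (p.fockLaw n).rnDeriv p.mix ω) =
        ∑' n, fun ω => ENNReal.ofReal (p.weight n) * (p.fockLaw n).rnDeriv p.mix ω := by
      funext ω
      rw [ENNReal.tsum_apply]
    rw [e, withDensity_tsum hm]
    conv_lhs => rw [mix_eq_sum]
    congr 1; funext n
    have e2 : (fun ω => ENNReal.ofReal (p.weight n) * (p.fockLaw n).rnDeriv p.mix ω) =
      ENNReal.ofReal (p.weight n) • (p.fockLaw n).rnDeriv p.mix := rfl
    rw [e2, withDensity_smul _ (Measure.measurable_rnDeriv _ _),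
      Measure.withDensity_rnDeriv_eq _ _ (p.fockLaw_absolutelyContinuous n)]
  have hF : Measurable
      (fun ω => ∑' n, ENNReal.ofReal (p.weight n) * (p.fockLaw n).rnDeriv p.mix ω) :=
    Measurable.tsum hm
  have h2 := Measure.rnDeriv_withDensity p.mix hF
  rw [← h1] at h2
  filter_upwards [h2, Measure.rnDeriv_self p.mix] with ω h3 h4
  rw [h4] at h3
  have h5 : ∀ n, ENNReal.ofReal (p.weight n) * (p.fockLaw n).rnDeriv p.mix ω ≠ ∞ := fun n =>
    ENNReal.ne_top_of_tsum_ne_top (by rw [← h3]; exact ENNReal.one_ne_top) n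
  have h6 := ENNReal.hasSum_toReal (f := fun n => ENNReal.ofReal (p.weight n) *
    (p.fockLaw n).rnDeriv p.mix ω) (by rw [← h3]; exact ENNReal.one_ne_top)
  rw [← ENNReal.tsum_toReal_eq h5, ← h3, ENNReal.toReal_one] at h6
  convert h6 using 2 with n
  rw [ENNReal.toReal_mul, ENNReal.toReal_ofReal (p.weight_pos n).le]
  rfl

/-- Under `P_n` the densities vanish off the class of `n` by singularity and are equal on it, since
the laws agree there. Total mass one fixes the common value. -/
lemma ae_mTendsto_condState (n : ℕ) :
    ∀ᵐ ω ∂p.fockLaw n, p.MTendsto ω (p.condState (p.classOf n)) := by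
  have hac := (p.fockLaw_absolutelyContinuous n).ae_le
  have h0 : ∀ᵐ ω ∂p.fockLaw n, ∀ m, m ∉ p.classOf n → p.density m ω = 0 := by
    rw [ae_all_iff]
    intro m
    by_cases hm : m ∈ p.classOf n
    · exact .of_forall fun ω h => absurd hm h
    · have : ∃ u, p.prob m u ≠ p.prob n u := by
        simpa [classOf] using hm
      filter_upwards [p.ae_density_eq_zero this] with ω hω _ using hω
  filter_upwards [h0, hac (ae_measure_cyl_pos p.mix), hac (ae_all_iff.2 p.tendsto_density),
    hac p.ae_hasSum_density] with ω h0 hpos htend hsum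
  have hmix : ∀ t, p.mix.real (cyl t ω) ≠ 0 := fun t =>
    (ENNReal.toReal_pos (hpos t).ne' (measure_ne_top _ _)).ne'
  have hcl : ∀ m ∈ p.classOf n, p.density m ω = p.density n ω := by
    intro m hm
    refine tendsto_nhds_unique (htend m) ?_
    simpa only [hm _] using htend n
  have hind : ∀ m, p.weight m * p.density m ω =
      (p.classOf n).indicator p.weight m * p.density n ω := by
    intro m
    by_cases hm : m ∈ p.classOf n
    · rw [hcl m hm, Set.indicator_of_mem hm]
    · rw [h0 m hm, Set.indicator_of_notMem hm, mul_zero, zero_mul]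
  have hS := p.tsum_indicator_weight_pos (p.mem_classOf_self n)
  have hval : p.density n ω = (∑' k, (p.classOf n).indicator p.weight k)⁻¹ := by
    have h1 := hsum.tsum_eq
    simp only [hind] at h1
    rw [tsum_mul_right] at h1
    exact eq_inv_of_mul_eq_one_right h1
  have hlim : ∀ m, p.weight m * p.density m ω =
      (p.classOf n).indicator p.weight m / ∑' k, (p.classOf n).indicator p.weight k := by
    intro m; rw [hind, hval, div_eq_mul_inv]
  have hsch := tendsto_tsum_abs_sub (f := fun t m => p.posterior t ω m)
    (fun t m => p.posterior_nonneg t ω m)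
    (fun m => mul_nonneg (p.weight_pos m).le (p.density_nonneg m ω))
    (fun t => p.hasSum_posterior (hmix t)) hsum (fun m => (htend m).const_mul _)
  unfold MTendsto
  have e : ∀ t, traceNorm (p.M t ω - p.condState (p.classOf n)) =
      ENNReal.ofReal (∑' m, |p.posterior t ω m - p.weight m * p.density m ω|) := by
    intro t
    rw [((p.isDiag_M t ω).sub (p.isDiag_condState (p.classOf n))).traceNorm_eq,
      ENNReal.ofReal_tsum_of_nonneg (fun m => abs_nonneg _)
        ((p.hasSum_posterior (hmix t)).summable.sub hsum.summable).abs]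
    congr 1; funext m
    rw [← hlim, ← Complex.ofReal_sub, Complex.norm_real, Real.norm_eq_abs]
  simp only [e]
  simpa using ENNReal.tendsto_ofReal hsch

lemma mTendsto_mInf {ω : Omega} {X : Op} (h : p.MTendsto ω X) :
    p.MTendsto ω (p.MInf ω) := by
  have hex : ∃ X, p.MTendsto ω X := ⟨X, h⟩
  rw [MInf, dif_pos hex]
  exact hex.choose_spec

lemma mInf_eq {ω : Omega} {X : Op} (h : p.MTendsto ω X) : p.MInf ω = X :=
  tendsto_nhds_unique (tendsto_of_tendsto_traceNorm (p.mTendsto_mInf h))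
    (tendsto_of_tendsto_traceNorm h)

/-- Indistinguishability is pairwise an equivalence relation, so a maximal set is a full class. The
empty word adds no constraint: it always has probability one. -/
lemma eq_classOf {𝒩 : Set ℕ} (h : Maximal p.Indistinguishable 𝒩) {n : ℕ} (hn : n ∈ 𝒩) :
    𝒩 = p.classOf n := by
  have hsub : 𝒩 ⊆ p.classOf n := by
    intro k hk w
    by_cases hw : w = []
    · rw [hw, prob_nil, prob_nil]
    · exact h.prop n hn k hk w hw
  refine h.eq_of_subset (fun a ha b hb w _ => ?_) hsub
  exact (hb w).trans (ha w).symm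

end Params

/-! ### The law of the outcomes for a general state -/

namespace State

variable (ρ : State)

/-- The diagonal of a state in the Fock basis. -/
def diag (n : ℕ) : ℝ := (inner ℂ (fock n) (ρ.op (fock n))).re

lemma inner_fock_op (n : ℕ) : inner ℂ (fock n) (ρ.op (fock n)) = (ρ.diag n : ℂ) :=
  Complex.eq_re_of_ofReal_le (ρ.isPositive.inner_nonneg_right _)

lemma diag_nonneg (n : ℕ) : 0 ≤ ρ.diag n :=
  (Complex.nonneg_iff.1 (ρ.isPositive.inner_nonneg_right _)).1

lemma hasSum_diag : HasSum ρ.diag 1 := by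
  have h1 : ∑' n, ρ.diag n = 1 := by
    have := ρ.trace_one
    simp only [tr, inner_fock_op] at this
    exact_mod_cast this
  have hs : Summable ρ.diag := by
    by_contra h
    rw [tsum_eq_zero_of_not_summable h] at h1
    exact zero_ne_one h1
  exact h1 ▸ hs.hasSum

lemma tr_mul_fockProj (𝒩 : Set ℕ) :
    tr (ρ.op * fockProj 𝒩) = ((∑' n, 𝒩.indicator ρ.diag n : ℝ) : ℂ) := by
  rw [tr, Complex.ofReal_tsum]
  congr 1; funext n
  rw [mul_apply_eq_comp, isDiag_fockProj, map_smul, inner_smul_right, inner_fock_op]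
  by_cases hn : n ∈ 𝒩 <;> simp [hn]

end State

namespace Params

variable (p : Params)

lemma law_cyl (ρ : State) (t : ℕ) (ω : Omega) :
    p.law ρ (cyl t ω) = ENNReal.ofReal (∑' n, ρ.diag n * p.prob n (word t ω)) := by
  obtain ⟨h1, h2⟩ := (p.exists_isOutcomeLaw ρ).choose_spec
  have h3 := h2 ω t
  change ((p.law ρ).real (cyl t ω) : ℂ) =
    tr (ρ.op * (star (p.wordOp (word t ω)) * p.wordOp (word t ω))) at h3
  rw [tr_wordOp] at h3
  have h4 : (p.law ρ).real (cyl t ω) = ∑' n, ρ.diag n * p.prob n (word t ω) := by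
    rw [← Complex.ofReal_inj, h3, Complex.ofReal_tsum]
    congr 1; funext n
    rw [ρ.inner_fock_op, ← Complex.ofReal_mul, mul_comm]
    rfl
  have : IsProbabilityMeasure (p.law ρ) := h1
  rw [← h4, ofReal_measureReal]

/-- Coherences of `ρ` do not affect the outcomes because `W_t* W_t` is diagonal. -/
lemma law_eq_sum (ρ : State) :
    p.law ρ = Measure.sum fun n => ENNReal.ofReal (ρ.diag n) • p.fockLaw n := by
  have : IsProbabilityMeasure (p.law ρ) := (p.exists_isOutcomeLaw ρ).choose_spec.1
  refine measure_ext_of_cyl fun ω t => ?_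
  have h0 : ∀ n, 0 ≤ ρ.diag n * p.prob n (word t ω) := fun n =>
    mul_nonneg (ρ.diag_nonneg n) (p.prob_nonneg _ _)
  rw [law_cyl, Measure.sum_apply _ (measurableSet_cyl t ω), ENNReal.ofReal_tsum_of_nonneg h0
    (ρ.hasSum_diag.summable.of_nonneg_of_le h0 fun n =>
      mul_le_of_le_one_right (ρ.diag_nonneg n) (p.prob_le_one _ _))]
  congr 1; funext n
  rw [Measure.smul_apply, fockLaw_cyl, smul_eq_mul, ENNReal.ofReal_mul (ρ.diag_nonneg n)]

lemma ae_law {ρ : State} {P : Omega → Prop} (h : ∀ n, ∀ᵐ ω ∂p.fockLaw n, P ω) :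
    ∀ᵐ ω ∂p.law ρ, P ω := by
  rw [law_eq_sum, Measure.ae_sum_iff]
  exact fun n => Measure.ae_smul_measure (h n) _

lemma law_real_mInf_eq {𝒩 : Set ℕ} (h𝒩 : Maximal p.Indistinguishable 𝒩) (ρ : State) :
    ((p.law ρ).real {ω | p.MInf ω = p.condState 𝒩} : ℂ) = tr (ρ.op * fockProj 𝒩) := by
  have h0 : ∀ n, 0 ≤ 𝒩.indicator ρ.diag n :=
    fun n => Set.indicator_nonneg (fun n _ => ρ.diag_nonneg n) n
  rw [ρ.tr_mul_fockProj, Complex.ofReal_inj, Measure.real, law_eq_sum,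
    -- A countable sum of measures can be evaluated on any set, so measurability of the event for
    -- `M_∞` is not needed.
    Measure.sum_apply_of_countable,
    ← ENNReal.toReal_ofReal (tsum_nonneg h0),
    ENNReal.ofReal_tsum_of_nonneg h0 (ρ.hasSum_diag.summable.indicator 𝒩)]
  congr 2; funext n
  rw [Measure.smul_apply, smul_eq_mul]
  by_cases hn : n ∈ 𝒩
  · have : ∀ᵐ ω ∂p.fockLaw n, p.MInf ω = p.condState 𝒩 := by
      filter_upwards [p.ae_mTendsto_condState n] with ω hω
      rw [p.mInf_eq hω, ← p.eq_classOf h𝒩 hn]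
    have h1 : p.fockLaw n {ω | p.MInf ω = p.condState 𝒩} = 1 := by
      rw [← measure_univ (μ := p.fockLaw n)]
      exact measure_congr (this.mono fun ω hω => propext ⟨fun _ => trivial, fun _ => hω⟩)
    rw [Set.indicator_of_mem hn, h1, mul_one]
  · have : ∀ᵐ ω ∂p.fockLaw n, ¬ p.MInf ω = p.condState 𝒩 := by
      filter_upwards [p.ae_mTendsto_condState n] with ω hω
      rw [p.mInf_eq hω]
      exact p.condState_classOf_ne hn
    rw [Set.indicator_of_notMem hn, ENNReal.ofReal_zero]
    have h1 : p.fockLaw n {ω | p.MInf ω = p.condState 𝒩} = 0 := by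
      simpa only [ae_iff, not_not] using this
    rw [h1, mul_zero]

end Params

/-! ### Mixtures of two Fock states -/

/-- The equal mixture of `|a⟩⟨a|` and `|b⟩⟨b|`. -/
def pairOp (a b : ℕ) : Op :=
  (1 / 2 : ℂ) • (InnerProductSpace.rankOne ℂ (fock a) (fock a) +
    InnerProductSpace.rankOne ℂ (fock b) (fock b))

/-- The eigenvalues of the mixture `pairOp a b`, multiplied by `q`. -/
def pairDiag (a b : ℕ) (q : ℝ) (n : ℕ) : ℝ := if n = a ∨ n = b then q / 2 else 0

lemma hasSum_pairDiag {a b : ℕ} (hab : a ≠ b) (q : ℝ) : HasSum (pairDiag a b q) q := by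
  have h : HasSum (pairDiag a b q) _ := hasSum_sum_of_ne_finset_zero (s := {a, b}) (by
    intro n hn
    simp only [Finset.mem_insert, Finset.mem_singleton] at hn
    simp [pairDiag, hn])
  rw [Finset.sum_pair hab] at h
  simpa [pairDiag] using h

/-- The image is `(|Aa⟩⟨Aa| + |Ab⟩⟨Ab|)/2`; the phases of `c` and `d` cancel, and equal moduli keep
the weights equal. -/
lemma isDiag_conj_pairOp {A : Op} {a b k l : ℕ} {c d : ℂ} {q : ℝ} (hkl : k ≠ l)
    (ha : A (fock a) = c • fock k) (hb : A (fock b) = d • fock l) (hc : ‖c‖ ^ 2 = q)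
    (hd : ‖d‖ ^ 2 = q) :
    IsDiag (A * pairOp a b * star A) fun n => (pairDiag k l q n : ℂ) := by
  intro n
  have hc' : star c * c = (q : ℂ) := by rw [Complex.star_def, Complex.conj_mul', ← hc]; norm_cast
  have hd' : star d * d = (q : ℂ) := by rw [Complex.star_def, Complex.conj_mul', ← hd]; norm_cast
  rw [mul_apply_eq_comp, mul_apply_eq_comp, pairOp, smul_apply, add_apply,
    InnerProductSpace.rankOne_apply, InnerProductSpace.rankOne_apply,
    ContinuousLinearMap.star_eq_adjoint, ContinuousLinearMap.adjoint_inner_right,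
    ContinuousLinearMap.adjoint_inner_right, map_smul, map_add, map_smul, map_smul, ha, hb,
    inner_smul_left, inner_smul_left, inner_fock_fock, inner_fock_fock]
  beta_reduce
  rcases eq_or_ne n k with rfl | hk
  · rw [if_pos rfl, if_neg hkl.symm, pairDiag, if_pos (.inl rfl), mul_one, mul_zero, zero_smul,
      add_zero, smul_smul, smul_smul, ← Complex.star_def, mul_assoc, hc']
    congr 1; push_cast; ring
  rcases eq_or_ne n l with rfl | hl
  · rw [if_pos rfl, if_neg hk.symm, pairDiag, if_pos (.inr rfl), mul_one, mul_zero, zero_smul,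
      zero_add, smul_smul, smul_smul, ← Complex.star_def, mul_assoc, hd']
    congr 1; push_cast; ring
  · rw [if_neg hk.symm, if_neg hl.symm, pairDiag, if_neg (by tauto)]
    simp

lemma isDiag_pairOp {a b : ℕ} (hab : a ≠ b) :
    IsDiag (pairOp a b) fun n => (pairDiag a b 1 n : ℂ) := by
  have := isDiag_conj_pairOp (A := 1) (q := 1) hab (one_smul ℂ (fock a)).symm
    (one_smul ℂ (fock b)).symm (by simp) (by simp)
  simpa using this

/-- The state `(|a⟩⟨a| + |b⟩⟨b|) / 2`. -/
def pairState {a b : ℕ} (hab : a ≠ b) : State where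
  op := pairOp a b
  isPositive := (ContinuousLinearMap.nonneg_iff_isPositive _).1
    ((isDiag_pairOp hab).nonneg fun n => by unfold pairDiag; positivity)
  traceClass := by
    rw [(isDiag_pairOp hab).traceNorm_eq]
    have h := hasSum_pairDiag hab 1
    have h0 : ∀ n, 0 ≤ pairDiag a b 1 n := fun n => by unfold pairDiag; positivity
    simp only [Complex.norm_real, Real.norm_eq_abs, abs_of_nonneg (h0 _)]
    rw [← ENNReal.ofReal_tsum_of_nonneg h0 h.summable]
    exact ENNReal.ofReal_ne_top
  trace_one := by
    rw [(isDiag_pairOp hab).tr_eq, ← Complex.ofReal_tsum, (hasSum_pairDiag hab 1).tsum_eq,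
      Complex.ofReal_one]

namespace Params

variable (p : Params)

/-- Along words of positive probability the two levels remain distinct and equally likely, so
normalisation always returns weights `1/2`. -/
lemma ae_distPure_traj {a b : ℕ} (hab : a ≠ b) (h : ∀ w, p.prob a w = p.prob b w) :
    ∀ᵐ ω ∂p.law (pairState hab), ∀ t, distPure (p.traj (pairState hab) t ω) = 1 := by
  filter_upwards [ae_measure_cyl_pos (p.law (pairState hab))] with ω hω t
  have hdiag : ∀ n, (pairState hab).diag n = pairDiag a b 1 n := fun n => by
    have := (isDiag_pairOp hab).inner_fock_apply n
    rw [State.diag, show (pairState hab).op = pairOp a b from rfl, this, Complex.ofReal_re]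
  have hq : p.prob a (word t ω) ≠ 0 := by
    intro h0
    have h1 := hω t
    have h2 : ∀ n, (pairState hab).diag n * p.prob n (word t ω) = 0 := by
      intro n
      rw [hdiag, pairDiag]
      split_ifs with hn
      · rcases hn with rfl | rfl
        · rw [h0, mul_zero]
        · rw [← h, h0, mul_zero]
      · rw [zero_mul]
    rw [law_cyl] at h1
    simp [h2] at h1
  have hqb : p.prob b (word t ω) ≠ 0 := by rwa [← h]
  have hpos : pos a (word t ω) ≠ pos b (word t ω) := by
    have := p.pos_eq_of_prob_ne_zero hq hqb
    intro he
    rw [he] at this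
    omega
  obtain ⟨c, hc⟩ := p.exists_wordOp_fock a (word t ω)
  obtain ⟨d, hd⟩ := p.exists_wordOp_fock b (word t ω)
  have hA := isDiag_conj_pairOp (q := p.prob a (word t ω)) hpos hc hd
    (by rw [prob, hc, norm_smul, norm_fock, mul_one])
    (by rw [h, prob, hd, norm_smul, norm_fock, mul_one])
  have htr := hA.tr_eq
  rw [← Complex.ofReal_tsum, (hasSum_pairDiag hpos _).tsum_eq] at htr
  refine distPure_pair hpos ?_
  have h3 := hA.smul (p.prob a (word t ω) : ℂ)⁻¹
  have e : ∀ n, (p.prob a (word t ω) : ℂ)⁻¹ *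
      (pairDiag (pos a (word t ω)) (pos b (word t ω)) (p.prob a (word t ω)) n : ℂ) =
      if n = pos a (word t ω) ∨ n = pos b (word t ω) then (1 / 2 : ℂ) else 0 := by
    intro n
    have hq' : (p.prob a (word t ω) : ℂ) ≠ 0 := by exact_mod_cast hq
    rw [pairDiag]
    split_ifs
    · push_cast; field_simp
    · simp
  simp only [e] at h3
  rw [← htr] at h3
  exact h3

end Params

end Maser
end

theorem proposition5p2 (p : Maser.Params) (𝒩 : Set ℕ) (h𝒩 : Maximal p.Indistinguishable 𝒩) :
    (∀ ρ : Maser.State,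
      (∀ᵐ ω ∂p.law ρ, p.MTendsto ω (p.MInf ω)) ∧
      ((p.law ρ).real {ω | p.MInf ω = (Maser.tr (p.rhoInv * Maser.fockProj 𝒩))⁻¹ •
          (Maser.fockProj 𝒩 * p.rhoInv * Maser.fockProj 𝒩)} : ℂ) =
        Maser.tr (ρ.op * Maser.fockProj 𝒩)) ∧
    (2 ≤ 𝒩.encard → ∃ ρ : Maser.State, ∀ᵐ ω ∂p.law ρ,
      (∀ t : ℕ, 1 ≤ t → Maser.distPure (p.traj ρ t ω) = 1) ∧
      ⨅ (t : ℕ) (_ : 1 ≤ t), Maser.distPure (p.traj ρ t ω) = 1) := by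
  refine ⟨fun ρ => ⟨p.ae_law fun n => ?_, p.law_real_mInf_eq h𝒩 ρ⟩, fun hcard => ?_⟩
  · filter_upwards [p.ae_mTendsto_condState n] with ω hω using p.mTendsto_mInf hω
  · obtain ⟨a, b, ha, hb, hab⟩ := Set.one_lt_encard_iff.1 (lt_of_lt_of_le (by norm_num) hcard)
    have h : ∀ w, p.prob a w = p.prob b w := by
      rw [p.eq_classOf h𝒩 hb] at ha
      exact ha
    refine ⟨Maser.pairState hab, ?_⟩
    filter_upwards [p.ae_distPure_traj hab h] with ω hω
    refine ⟨fun t _ => hω t, ?_⟩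
    simp only [hω]
    exact le_antisymm (iInf₂_le 1 le_rfl) (le_iInf₂ fun _ _ => le_rfl)
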